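/- **Theorem 4.3 (Newton iteration).** Let $d\in\{2,3\}$ and let $\Omega\subset\mathbb R^d$ be a bounded open set. Put $X=H^1_0(\Omega)^d$, $Z=H^1_0(\Omega)$, let $Y=H_0(\mathrm{div},\Omega)$ be the closure of $C_c^\infty(\Omega)^d$ in $H(\mathrm{div},\Omega)$, let $L^2_0(\Omega)$ be the space of $L^2$ functions with mean zero, and $$\|(w,K)\|_1=\big(\|\nabla w\|_0^2+\|K\|_0^2+\|\nabla\!\cdot\! K\|_0^2\big)^{1/2},\qquad \|(q,\psi)\|_0=\big(\|q\|_0^2+\|\psi\|_0^2\big)^{1/2}.$$ Let $\lambda_1,\lambda_2,C_\Omega>0$ be constants such that $\|v\|_{L^6}\le\lambda_1\|\nabla v\|_0$, $\|v\|_{L^4}^2\le\lambda_2\|\nabla v\|_0^2$ and $\|v\|_0\le C_\Omega\|\nabla v\|_0$ for all $v\in X$ and for all $v\in Z$. *Data.* Let $Pr,\kappa>0$, $Ra\ge 0$, let $\mathbf i\in\mathbb R^d$ be a unit vector, $B\in L^3(\Omega)^3$ with $B=(0,0,B_3)$ if $d=2$ (planar vectors are padded by a zero third component in cross products), $f\in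 X'=H^{-1}(\Omega)^d$, $g\in L^2(\Omega)^d$, $\varphi\in Z'=H^{-1}(\Omega)$. For $\eta=(u,J)$, $\Phi=(v,K)$, $\omega=(w,M)$ in $X\times Y$, $\chi=(q,\psi)\in L^2(\Omega)^2$ and $\theta,r\in Z$ put $$\mathcal A_0(\eta,\Phi)=Pr(\nabla u,\nabla v)+\kappa(J,K)-\kappa(J\times B,v)+\kappa(K\times B,u),\qquad \mathcal B(\chi,\Phi)=-Pr(q,\nabla\!\cdot v)-\kappa(\psi,\nabla\!\cdot K),$$ $$\mathcal A_1(\omega,\eta,\Phi)=\tfrac12((w\cdot\nabla)u,v)-\tfrac12((w\cdot\nabla)v,u),\qquad \mathcal H(\omega,\theta,r)=\tfrac12((w\cdot\nabla)\theta,r)-\tfrac12((w\cdot\nabla)r,\theta),$$ $$\mathcal Q(\theta,\Phi)=-Pr\,Ra\,(\theta\,\mathbf i,v),\qquad e(\theta,r)=(\nabla\theta,\nabla r),\qquad \langle L,\Phi\rangle=\langle f,v\rangle+\kappa(g,K).$$ Let $\|f\|_{-1}=\sup_{0\ne v\in X}\langle f,v\rangle/\|\nabla v\|_0$, $\lambda_\varphi=\sup_{0\ne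 r\in Z}\langle\varphi,r\rangle/\|\nabla r\|_0$, $\|L\|_*=(\|f\|_{-1}^2+\kappa^2\|g\|_0^2)^{1/2}$, $\lambda_q=Pr\,Ra\,C_\Omega^2$, $C_{\min}=\min\{Pr,\kappa\}$, $C_{\max}=2\max\{Pr,\kappa,\kappa\lambda_1\|B\|_{L^3}\}$, and $$\sigma=\frac{\lambda_2\|L\|_*}{C_{\min}^2}+\frac{\lambda_2\lambda_q\lambda_\varphi}{C_{\min}^2}+\frac{\lambda_2\lambda_q\lambda_\varphi}{C_{\min}}+\frac{\lambda_2\|L\|_*}{C_{\min}},\qquad R=\frac{\|L\|_*+\lambda_q\lambda_\varphi}{C_{\min}}.$$ *Discretization.* Let $X_h\subset X$, $Y_h\subset Y$, $E_h,S_h\subset L^2_0(\Omega)$, $Z_h\subset Z$ be finite-dimensional subspaces with $\nabla\!\cdot Y_h\subset S_h$, and let $\beta_s,\beta_m>0$ satisfy $$\sup_{0\ne w\in X_h}\frac{-Pr(q,\nabla\!\cdot w)}{\|\nabla w\|_0\,\|q\|_0}\ge\beta_s\quad(0\ne q\in E_h),\qquad \sup_{0\ne K\in Y_h}\frac{-\kappa(\psi,\nabla\!\cdot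 K)}{\|K\|_{\mathrm{div}}\,\|\psi\|_0}\ge\beta_m\quad(0\ne\psi\in S_h),$$ where $\|K\|_{\mathrm{div}}^2=\|K\|_0^2+\|\nabla\!\cdot K\|_0^2$. Put $\beta^*=\min\{\beta_s,\beta_m\}$, $D_h=X_h\times Y_h$, $G_h=E_h\times S_h$. Below, unknowns and test functions are in $D_h\times G_h\times Z_h$ and the equations hold for all test functions $(\Phi,\chi,r)$. - Discrete problem: $(\eta_h,\xi_h,\theta_h)$ with $\mathcal A_0(\eta_h,\Phi)+\mathcal A_1(\eta_h,\eta_h,\Phi)+\mathcal B(\xi_h,\Phi)+\mathcal Q(\theta_h,\Phi)=\langle L,\Phi\rangle$, $\mathcal B(\chi,\eta_h)=0$, $e(\theta_h,r)+\mathcal H(\eta_h,\theta_h,r)=\langle\varphi,r\rangle$. - Initial iterate: $(\eta_h^0,\xi_h^0,\theta_h^0)$ with $\mathcal A_0(\eta_h^0,\Phi)+\mathcal B(\xi_h^0,\Phi)+\mathcal Q(\theta_h^0,\Phi)=\langle L,\Phi\rangle$, $\mathcal B(\chi,\eta_h^0)=0$, $e(\theta_h^0,r)=\langle\varphi,r\rangle$.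 - Newton iteration (Method II), $n\ge1$: $(\eta_h^n,\xi_h^n,\theta_h^n)$ with $$\mathcal A_0(\eta_h^n,\Phi)+\mathcal A_1(\eta_h^{n-1},\eta_h^n,\Phi)+\mathcal A_1(\eta_h^n,\eta_h^{n-1},\Phi)-\mathcal A_1(\eta_h^{n-1},\eta_h^{n-1},\Phi)+\mathcal B(\xi_h^n,\Phi)+\mathcal Q(\theta_h^n,\Phi)=\langle L,\Phi\rangle,$$ $$\mathcal B(\chi,\eta_h^n)=0,\qquad e(\theta_h^n,r)+\mathcal H(\eta_h^{n-1},\theta_h^n,r)+\mathcal H(\eta_h^n,\theta_h^{n-1},r)-\mathcal H(\eta_h^{n-1},\theta_h^{n-1},r)=\langle\varphi,r\rangle.$$ *Claim.* If $0<\sigma<\frac13$, then the discrete problem, the problem for the initial iterate and every Newton step each have exactly one solution, and for all $n\ge0$ $$\|\eta_h^n\|_1\le\tfrac43R,\qquad \|\nabla\theta_h^n\|_0\le\tfrac43\lambda_\varphi,$$ $$\|\eta_h-\eta_h^n\|_1\le\big(\tfrac95\sigma\big)^{2^n-1}R,\qquad \|\nabla(\theta_h-\theta_h^n)\|_0\le\big(\tfrac95\sigma\big)^{2^n-1}\lambda_\varphi,$$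 $$\beta^*\|\xi_h-\xi_h^n\|_0\le\big(C_{\max}+\tfrac{22}{9}C_{\min}\big)\big(\tfrac95\sigma\big)^{2^n-1}R.$$ -/

import Mathlib

open MeasureTheory
open scoped ContDiff

noncomputable section

namespace IMHD

/-- `L²(Ω; F)` for `Ω ⊆ ℝᵈ`; `‖·‖` is the usual `L²` norm and `inner ℝ` the usual `L²` product. -/
abbrev L2 {d : ℕ} (Ω : Set (EuclideanSpace ℝ (Fin d))) (F : Type) [NormedAddCommGroup F] :=
  Lp F 2 (volume.restrict Ω)

/-- `H¹₀(Ω)`: the closure in `H¹` of the smooth functions with compact support in `Ω`.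
An element is stored as the pair (function, gradient). -/
def H10 {d : ℕ} (Ω : Set (EuclideanSpace ℝ (Fin d))) :
    Submodule ℝ (L2 Ω ℝ × L2 Ω (EuclideanSpace ℝ (Fin d))) :=
  (Submodule.span ℝ {p | ∃ φ : EuclideanSpace ℝ (Fin d) → ℝ,
    ContDiff ℝ ∞ φ ∧ HasCompactSupport φ ∧ tsupport φ ⊆ Ω ∧
    p.1 =ᵐ[volume.restrict Ω] φ ∧
    p.2 =ᵐ[volume.restrict Ω] fun x => gradient φ x}).topologicalClosure

/-- `H₀(div, Ω)`: the closure in `H(div)` of the smooth vector fields with compact support in `Ω`.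
An element is stored as the pair (field, divergence). -/
def H0div {d : ℕ} (Ω : Set (EuclideanSpace ℝ (Fin d))) :
    Submodule ℝ (L2 Ω (EuclideanSpace ℝ (Fin d)) × L2 Ω ℝ) :=
  (Submodule.span ℝ {p | ∃ K : EuclideanSpace ℝ (Fin d) → EuclideanSpace ℝ (Fin d),
    ContDiff ℝ ∞ K ∧ HasCompactSupport K ∧ tsupport K ⊆ Ω ∧
    p.1 =ᵐ[volume.restrict Ω] K ∧
    p.2 =ᵐ[volume.restrict Ω]
      fun x => ∑ i, fderiv ℝ K x (EuclideanSpace.single i 1) i}).topologicalClosure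

/-- `L²₀(Ω)`: square integrable functions with mean zero. -/
def L20 {d : ℕ} (Ω : Set (EuclideanSpace ℝ (Fin d))) : Set (L2 Ω ℝ) :=
  {q | ∫ x in Ω, q x = 0}

section Spaces

variable {d : ℕ} {Ω : Set (EuclideanSpace ℝ (Fin d))}

/-- The `L²` function underlying an element of `H¹₀(Ω)`. -/
def fn (r : H10 Ω) : L2 Ω ℝ := r.1.1

/-- The gradient of an element of `H¹₀(Ω)`. -/
def grad (r : H10 Ω) : L2 Ω (EuclideanSpace ℝ (Fin d)) := r.1.2

/-- The `L²` field underlying an element of `H₀(div, Ω)`. -/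
def fld (K : H0div Ω) : L2 Ω (EuclideanSpace ℝ (Fin d)) := K.1.1

/-- The divergence of an element of `H₀(div, Ω)`. -/
def dv (K : H0div Ω) : L2 Ω ℝ := K.1.2

end Spaces

/-- The velocity space `H¹₀(Ω)ᵈ`. -/
abbrev Vel {d : ℕ} (Ω : Set (EuclideanSpace ℝ (Fin d))) := Fin d → H10 Ω

section Norms

variable {d : ℕ} {Ω : Set (EuclideanSpace ℝ (Fin d))}

/-- The vector value `v(x)` of a velocity field. -/
def Vel.val (v : Vel Ω) (x : EuclideanSpace ℝ (Fin d)) : EuclideanSpace ℝ (Fin d) :=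
  WithLp.toLp 2 fun i => fn (v i) x

/-- `(∇v, ∇w)`, the sum of the products of all the partial derivatives. -/
def gradInner (v w : Vel Ω) : ℝ := ∑ i, inner ℝ (grad (v i)) (grad (w i))

/-- `‖∇v‖₀` for a velocity field. -/
def gradNorm (v : Vel Ω) : ℝ := √(∑ i, ‖grad (v i)‖ ^ 2)

/-- `‖K‖_div`. -/
def divNorm (K : H0div Ω) : ℝ := √(‖fld K‖ ^ 2 + ‖dv K‖ ^ 2)

/-- `‖(w, K)‖₁`. -/
def norm1 (η : Vel Ω × H0div Ω) : ℝ := √(gradNorm η.1 ^ 2 + divNorm η.2 ^ 2)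

/-- `‖(q, ψ)‖₀`. -/
def norm0 (ξ : L2 Ω ℝ × L2 Ω ℝ) : ℝ := √(‖ξ.1‖ ^ 2 + ‖ξ.2‖ ^ 2)

/-- `‖f‖₋₁` for a functional on the velocity space. -/
def dualNormVel (f : Vel Ω →L[ℝ] ℝ) : ℝ := sSup {t | ∃ v : Vel Ω, v ≠ 0 ∧ t = f v / gradNorm v}

/-- `‖φ‖₋₁` for a functional on `H¹₀(Ω)`. -/
def dualNorm (φ : H10 Ω →L[ℝ] ℝ) : ℝ := sSup {t | ∃ r : H10 Ω, r ≠ 0 ∧ t = φ r / ‖grad r‖}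

end Norms

/-- `l1`, `l2`, `C` are positive constants for the embeddings of `H¹₀(Ω)` and `H¹₀(Ω)ᵈ` into
`L⁶`, `L⁴` and `L²`. This pins down what the constants of the estimates stand for. -/
structure EmbeddingConstants {d : ℕ} (Ω : Set (EuclideanSpace ℝ (Fin d))) (l1 l2 C : ℝ) :
    Prop where
  l1_pos : 0 < l1
  l2_pos : 0 < l2
  C_pos : 0 < C
  vel_L6 : ∀ v : Vel Ω,
    eLpNorm v.val 6 (volume.restrict Ω) ≤ ENNReal.ofReal (l1 * gradNorm v)
  vel_L4 : ∀ v : Vel Ω,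
    eLpNorm v.val 4 (volume.restrict Ω) ^ 2 ≤ ENNReal.ofReal (l2 * gradNorm v ^ 2)
  vel_L2 : ∀ v : Vel Ω,
    eLpNorm v.val 2 (volume.restrict Ω) ≤ ENNReal.ofReal (C * gradNorm v)
  scal_L6 : ∀ r : H10 Ω,
    eLpNorm (fn r) 6 (volume.restrict Ω) ≤ ENNReal.ofReal (l1 * ‖grad r‖)
  scal_L4 : ∀ r : H10 Ω,
    eLpNorm (fn r) 4 (volume.restrict Ω) ^ 2 ≤ ENNReal.ofReal (l2 * ‖grad r‖ ^ 2)
  scal_L2 : ∀ r : H10 Ω,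
    eLpNorm (fn r) 2 (volume.restrict Ω) ≤ ENNReal.ofReal (C * ‖grad r‖)

/-- The data of the stationary thermally coupled inductionless MHD problem. -/
structure Data {d : ℕ} (Ω : Set (EuclideanSpace ℝ (Fin d))) where
  /-- Prandtl number -/
  Pr : ℝ
  /-- coupling number -/
  κ : ℝ
  /-- Rayleigh number -/
  Ra : ℝ
  /-- direction of the buoyancy force -/
  dir : EuclideanSpace ℝ (Fin d)
  /-- applied magnetic field, always with three components -/
  B : EuclideanSpace ℝ (Fin d) → EuclideanSpace ℝ (Fin 3)
  /-- external force in `H⁻¹(Ω)ᵈ` -/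
  f : Vel Ω →L[ℝ] ℝ
  /-- external source in `L²(Ω)ᵈ` -/
  g : L2 Ω (EuclideanSpace ℝ (Fin d))
  /-- heat source in `H⁻¹(Ω)` -/
  φ : H10 Ω →L[ℝ] ℝ

/-- A vector of `ℝ²` or `ℝ³` read as a vector of `ℝ³`, the missing component being zero. -/
def pad {d : ℕ} (v : EuclideanSpace ℝ (Fin d)) : Fin 3 → ℝ :=
  fun k => if h : (k : ℕ) < d then v ⟨k, h⟩ else 0

namespace Data

variable {d : ℕ} {Ω : Set (EuclideanSpace ℝ (Fin d))} (P : Data Ω)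

/-- `d(K, v) = -κ (K × B, v)`. -/
def dForm (K : H0div Ω) (v : Vel Ω) : ℝ :=
  -P.κ * ∫ x in Ω, dotProduct (crossProduct (pad (fld K x)) (P.B x).ofLp) (pad (v.val x))

/-- `b_s(q, v) = -Pr (q, ∇·v)`. -/
def bs (q : L2 Ω ℝ) (v : Vel Ω) : ℝ := -P.Pr * ∫ x in Ω, q x * ∑ i, grad (v i) x i

/-- `b_m(ψ, K) = -κ (ψ, ∇·K)`. -/
def bm (ψ : L2 Ω ℝ) (K : H0div Ω) : ℝ := -P.κ * inner ℝ ψ (dv K)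

/-- `𝒜₀((u, J), (v, K))`. -/
def A0 (η Φ : Vel Ω × H0div Ω) : ℝ :=
  P.Pr * gradInner η.1 Φ.1 + P.κ * inner ℝ (fld η.2) (fld Φ.2) + P.dForm η.2 Φ.1 - P.dForm Φ.2 η.1

/-- `ℬ((q, ψ), (v, K))`. -/
def B0 (ξ : L2 Ω ℝ × L2 Ω ℝ) (Φ : Vel Ω × H0div Ω) : ℝ := P.bs ξ.1 Φ.1 + P.bm ξ.2 Φ.2

/-- `𝒬(θ, (v, K)) = -Pr Ra (θ i, v)`. -/
def Q (θ : H10 Ω) (Φ : Vel Ω × H0div Ω) : ℝ :=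
  -P.Pr * P.Ra * ∫ x in Ω, fn θ x * inner ℝ P.dir (Φ.1.val x)

/-- `⟨L, (v, K)⟩ = ⟨f, v⟩ + κ (g, K)`. -/
def L (Φ : Vel Ω × H0div Ω) : ℝ := P.f Φ.1 + P.κ * inner ℝ P.g (fld Φ.2)

/-- `‖L‖_*`. -/
def normL : ℝ := √(dualNormVel P.f ^ 2 + P.κ ^ 2 * ‖P.g‖ ^ 2)

/-- `λ_φ = ‖φ‖₋₁`. -/
def lamφ : ℝ := dualNorm P.φ

/-- `λ_q = Pr Ra C_Ω²`. -/
def lamq (C : ℝ) : ℝ := P.Pr * P.Ra * C ^ 2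

/-- `C_min`. -/
def Cmin : ℝ := min P.Pr P.κ

/-- `C_max`. -/
def Cmax (l1 : ℝ) : ℝ :=
  2 * max (max P.Pr P.κ) (P.κ * l1 * (eLpNorm P.B 3 (volume.restrict Ω)).toReal)

/-- The smallness parameter `σ`. -/
def sigma (l2 C : ℝ) : ℝ :=
  l2 * P.normL / P.Cmin ^ 2 + l2 * P.lamq C * P.lamφ / P.Cmin ^ 2 +
    l2 * P.lamq C * P.lamφ / P.Cmin + l2 * P.normL / P.Cmin

/-- The a priori bound `(‖L‖_* + λ_q λ_φ) / C_min`. -/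
def bound (C : ℝ) : ℝ := (P.normL + P.lamq C * P.lamφ) / P.Cmin

end Data

section Trilinear

variable {d : ℕ} {Ω : Set (EuclideanSpace ℝ (Fin d))}

/-- `((u·∇)v, w)`. -/
def conv (u v w : Vel Ω) : ℝ :=
  ∫ x in Ω, ∑ i, (∑ j, fn (u j) x * grad (v i) x j) * fn (w i) x

/-- `((u·∇)θ, r)`. -/
def convT (u : Vel Ω) (θ r : H10 Ω) : ℝ := ∫ x in Ω, (∑ j, fn (u j) x * grad θ x j) * fn r x

/-- `𝒜₁((w, M), (u, J), (v, K))`. -/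
def A1 (ζ η Φ : Vel Ω × H0div Ω) : ℝ :=
  1 / 2 * conv ζ.1 η.1 Φ.1 - 1 / 2 * conv ζ.1 Φ.1 η.1

/-- `ℋ((u, J), θ, r)`. -/
def H (η : Vel Ω × H0div Ω) (θ r : H10 Ω) : ℝ := 1 / 2 * convT η.1 θ r - 1 / 2 * convT η.1 r θ

/-- `e(θ, r) = (∇θ, ∇r)`. -/
def eForm (θ r : H10 Ω) : ℝ := inner ℝ (grad θ) (grad r)

end Trilinear

/-- Conforming discrete spaces: finite dimensional subspaces `X_h ⊆ H¹₀(Ω)ᵈ`, `Y_h ⊆ H₀(div, Ω)`,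
`E_h, S_h ⊆ L²₀(Ω)`, `Z_h ⊆ H¹₀(Ω)`. -/
structure FESpaces {d : ℕ} (Ω : Set (EuclideanSpace ℝ (Fin d))) where
  Xh : Submodule ℝ (Vel Ω)
  Yh : Submodule ℝ (H0div Ω)
  Eh : Submodule ℝ (L2 Ω ℝ)
  Sh : Submodule ℝ (L2 Ω ℝ)
  Zh : Submodule ℝ (H10 Ω)
  finXh : FiniteDimensional ℝ Xh
  finYh : FiniteDimensional ℝ Yh
  finEh : FiniteDimensional ℝ Eh
  finSh : FiniteDimensional ℝ Sh
  finZh : FiniteDimensional ℝ Zh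
  Eh_mean : (Eh : Set (L2 Ω ℝ)) ⊆ L20 Ω
  Sh_mean : (Sh : Set (L2 Ω ℝ)) ⊆ L20 Ω

namespace FESpaces

variable {d : ℕ} {Ω : Set (EuclideanSpace ℝ (Fin d))} (V : FESpaces Ω)

/-- A discrete state `((u_h, J_h), (p_h, φ_h), θ_h)`; also used for test functions. -/
abbrev State := (V.Xh × V.Yh) × (V.Eh × V.Sh) × V.Zh

variable {V}

/-- `η_h = (u_h, J_h)`. -/
def State.eta (s : V.State) : Vel Ω × H0div Ω := (s.1.1, s.1.2)

/-- `ξ_h = (p_h, φ_h)`. -/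
def State.xi (s : V.State) : L2 Ω ℝ × L2 Ω ℝ := (s.2.1.1, s.2.1.2)

/-- `θ_h`. -/
def State.theta (s : V.State) : H10 Ω := s.2.2

end FESpaces

section Problems

variable {d : ℕ} {Ω : Set (EuclideanSpace ℝ (Fin d))} (P : Data Ω) (V : FESpaces Ω)

/-- The inf-sup condition for `b_s` on `X_h × E_h` with constant `β`. -/
def InfSupS (β : ℝ) : Prop :=
  ∀ q ∈ V.Eh, q ≠ 0 →
    β ≤ sSup {t | ∃ w ∈ V.Xh, w ≠ 0 ∧ t = P.bs q w / (gradNorm w * ‖q‖)}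

/-- The inf-sup condition for `b_m` on `Y_h × S_h` with constant `β`. -/
def InfSupM (β : ℝ) : Prop :=
  ∀ ψ ∈ V.Sh, ψ ≠ 0 →
    β ≤ sSup {t | ∃ K ∈ V.Yh, K ≠ 0 ∧ t = P.bm ψ K / (divNorm K * ‖ψ‖)}

variable {V}

/-- `s` solves the discrete nonlinear problem. -/
def IsDiscreteSolution (s : V.State) : Prop :=
  ∀ t : V.State,
    P.A0 s.eta t.eta + A1 s.eta s.eta t.eta + P.B0 s.xi t.eta + P.Q s.theta t.eta = P.L t.eta ∧
    P.B0 t.xi s.eta = 0 ∧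
    eForm s.theta t.theta + H s.eta s.theta t.theta = P.φ t.theta

/-- `s` solves the linear problem that defines the initial iterate. -/
def IsInitial (s : V.State) : Prop :=
  ∀ t : V.State,
    P.A0 s.eta t.eta + P.B0 s.xi t.eta + P.Q s.theta t.eta = P.L t.eta ∧
    P.B0 t.xi s.eta = 0 ∧
    eForm s.theta t.theta = P.φ t.theta

/-- `s` solves the linear problem of one Newton step from the iterate `o`. -/
def IsNewtonStep (o s : V.State) : Prop :=
  ∀ t : V.State,
    P.A0 s.eta t.eta + A1 o.eta s.eta t.eta + A1 s.eta o.eta t.eta - A1 o.eta o.eta t.eta +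
      P.B0 s.xi t.eta + P.Q s.theta t.eta = P.L t.eta ∧
    P.B0 t.xi s.eta = 0 ∧
    eForm s.theta t.theta + H o.eta s.theta t.theta + H s.eta o.theta t.theta -
      H o.eta o.theta t.theta = P.φ t.theta

end Problems

end IMHD

end

open IMHD

noncomputable section

namespace IMHD

/-! Write c for `Cmin`, l for λ₂ and lL, lq, lφ for ‖L‖_*, λ_q, λ_φ. Two facts about the constants
drive every estimate: σ factors as cσ = lR(1 + c), and lq·lφ ≤ cR. If a perturbation of the
transport field has size δ, it enters the momentum equation as lRδ and the heat equation as l·lφ·δ.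
The latter returns through buoyancy as at most lq·l·lφ·δ ≤ c·lRδ. Both together are cσδ, so after
division by c the velocity and current are perturbed by at most σδ.

The division by c is legitimate when a difference of two solutions is used as test function. The
transport forms are skew in their last two arguments, so the principal transport term drops out. The
multiplier term drops out because the difference lies in the kernel of the constraint. On that
kernel `A0` is coercive: the magnetic coupling is skew, and ∇·Y_h ⊂ S_h makes discrete currents
exactly divergence free.

For the nonlinear problem, freezing the transport field gives a linear problem whose solution map is
a σ-contraction (`picard_contraction`); its fixed point is the solution. For Newton's method the
error solves the linearised problem with the quadratic Taylor remainder as source. If the old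
relative error is ε, then X ≤ (4/3)σX + σε²R, and σ < 1/3 allows absorption with factor 1/(1 - 4/9)
= 9/5 (`newton_error`). The recursion ε ↦ (9/5)σε² started at ε = 1 gives the exponent 2^n - 1. The
iterates stay within relative distance σ of the solution, a set that contains the initial iterate
(`stokes_error`) and is invariant under Newton steps; this yields the bounds with 4/3. The inf-sup
condition turns each residual bound into a bound for the multipliers.

Each linear problem is square, so its solvability reduces to `homogeneous_eq_zero`. All this is done
for abstract forms subject to `Estimates`. What remains analytic is to verify those estimates by
Hölder's inequality with the embedding constants (`estimates_pulledBackForms`) and to merge the two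
inf-sup conditions (`infSup_combined`). -/

/-- A map on a finite dimensional space that contracts a definite seminorm has a fixed point. -/
theorem exists_fixedPoint_of_seminorm {E : Type*} [AddCommGroup E] [Module ℝ E]
    [FiniteDimensional ℝ E] (p : Seminorm ℝ E) (hp : ∀ x, p x = 0 → x = 0) (T : E → E) {k : ℝ}
    (hk0 : 0 ≤ k) (hk : k < 1) (hT : ∀ x y, p (T x - T y) ≤ k * p (x - y)) : ∃ x, T x = x := by
  -- The definite seminorm becomes the norm of the space, and finite dimension makes it complete, so
  -- Banach's theorem applies.
  let _ : Norm E := ⟨p⟩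
  have core : NormedSpace.Core ℝ E :=
    { norm_nonneg := fun x => apply_nonneg p x
      norm_smul := fun c x => map_smul_eq_mul p c x
      norm_triangle := fun x y => map_add_le_add p x y
      norm_eq_zero_iff := fun x => ⟨hp x, fun h => by rw [h]; exact map_zero p⟩ }
  let _ : NormedAddCommGroup E := NormedAddCommGroup.ofCore core
  let _ : NormedSpace ℝ E := NormedSpace.ofCore core
  have _ : CompleteSpace E := FiniteDimensional.complete ℝ E
  have hc : ContractingWith ⟨k, hk0⟩ T := by
    refine ⟨by exact_mod_cast hk, LipschitzWith.of_dist_le_mul fun x y => ?_⟩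
    rw [dist_eq_norm, dist_eq_norm]
    exact hT x y
  exact ⟨hc.fixedPoint, hc.fixedPoint_isFixedPt⟩

/-! ### Abstract coupled saddle point problems in finite dimensions -/

section LinearProblem

variable {D G Z : Type*} [AddCommGroup D] [Module ℝ D] [AddCommGroup G] [Module ℝ G]
  [AddCommGroup Z] [Module ℝ Z]

/-- A square linear saddle point problem coupled to a third equation is uniquely solvable if the
homogeneous problem is. -/
theorem exists_unique_linearProblem [FiniteDimensional ℝ D] [FiniteDimensional ℝ G]
    [FiniteDimensional ℝ Z] (a : D →ₗ[ℝ] D →ₗ[ℝ] ℝ) (b : G →ₗ[ℝ] D →ₗ[ℝ] ℝ)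
    (q : Z →ₗ[ℝ] D →ₗ[ℝ] ℝ) (e : Z →ₗ[ℝ] Z →ₗ[ℝ] ℝ) (k : D →ₗ[ℝ] Z →ₗ[ℝ] ℝ)
    (hinj : ∀ x g z, (∀ y, a x y + b g y + q z y = 0) → (∀ g', b g' x = 0) →
      (∀ r, e z r + k x r = 0) → x = 0 ∧ g = 0 ∧ z = 0)
    (l : D →ₗ[ℝ] ℝ) (m : Z →ₗ[ℝ] ℝ) :
    ∃ s : D × G × Z, ∀ y : D × G × Z,
      (∀ t : D × G × Z, a y.1 t.1 + b y.2.1 t.1 + q y.2.2 t.1 = l t.1 ∧ b t.2.1 y.1 = 0 ∧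
        e y.2.2 t.2.2 + k y.1 t.2.2 = m t.2.2) ↔ y = s := by
  -- The operator takes an unknown to its three residual functionals; domain and codomain have equal
  -- dimension because a space and its dual do.
  let Λ : (D × G × Z) →ₗ[ℝ] (Module.Dual ℝ D × Module.Dual ℝ G × Module.Dual ℝ Z) :=
    LinearMap.prod (a.coprod (b.coprod q))
      (LinearMap.prod (b.flip ∘ₗ LinearMap.fst ℝ D (G × Z))
        (k.coprod (e ∘ₗ LinearMap.snd ℝ G Z)))
  have hΛ : ∀ y, Λ y = (a y.1 + (b y.2.1 + q y.2.2), b.flip y.1, k y.1 + e y.2.2) := fun y => rfl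
  have hi : Function.Injective Λ := by
    refine (injective_iff_map_eq_zero Λ).2 fun y hy => ?_
    rw [hΛ] at hy
    simp only [Prod.mk_eq_zero] at hy
    obtain ⟨h1, h2, h3⟩ := hy
    obtain ⟨hx, hg, hz⟩ := hinj y.1 y.2.1 y.2.2
      (fun t => by have := LinearMap.congr_fun h1 t; simpa [add_assoc] using this)
      (fun t => by simpa using LinearMap.congr_fun h2 t)
      (fun t => by have := LinearMap.congr_fun h3 t; simpa [add_comm] using this)
    exact Prod.ext hx (Prod.ext hg hz)
  have hfr : Module.finrank ℝ (D × G × Z) =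
      Module.finrank ℝ (Module.Dual ℝ D × Module.Dual ℝ G × Module.Dual ℝ Z) := by
    simp [Module.finrank_prod, Subspace.dual_finrank_eq]
  obtain ⟨s, hs⟩ := (LinearMap.injective_iff_surjective_of_finrank_eq_finrank hfr).1 hi (l, 0, m)
  refine ⟨s, fun y => ?_⟩
  have key : (∀ t : D × G × Z, a y.1 t.1 + b y.2.1 t.1 + q y.2.2 t.1 = l t.1 ∧
      b t.2.1 y.1 = 0 ∧ e y.2.2 t.2.2 + k y.1 t.2.2 = m t.2.2) ↔ Λ y = (l, 0, m) := by
    rw [hΛ]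
    simp only [Prod.mk.injEq]
    constructor
    · intro h
      refine ⟨?_, ?_, ?_⟩
      · ext t
        have := (h (t, 0, 0)).1
        simpa [add_assoc] using this
      · ext t
        simpa using (h (0, t, 0)).2.1
      · ext t
        have := (h (0, 0, t)).2.2
        simpa [add_comm] using this
    · rintro ⟨h1, h2, h3⟩ t
      refine ⟨?_, ?_, ?_⟩
      · simpa [add_assoc] using LinearMap.congr_fun h1 t.1
      · simpa using LinearMap.congr_fun h2 t.2.1
      · simpa [add_comm] using LinearMap.congr_fun h3 t.2.2
  rw [key, ← hs]
  exact hi.eq_iff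

/-- The forms and functionals of a saddle point problem with a quadratic nonlinearity, coupled to a
transport-diffusion equation. -/
structure CoupledForms (D G Z : Type*) [AddCommGroup D] [Module ℝ D] [AddCommGroup G] [Module ℝ G]
    [AddCommGroup Z] [Module ℝ Z] where
  a : D →ₗ[ℝ] D →ₗ[ℝ] ℝ
  n : D →ₗ[ℝ] D →ₗ[ℝ] D →ₗ[ℝ] ℝ
  b : G →ₗ[ℝ] D →ₗ[ℝ] ℝ
  q : Z →ₗ[ℝ] D →ₗ[ℝ] ℝ
  e : Z →ₗ[ℝ] Z →ₗ[ℝ] ℝ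
  h : D →ₗ[ℝ] Z →ₗ[ℝ] Z →ₗ[ℝ] ℝ
  L : D →ₗ[ℝ] ℝ
  φ : Z →ₗ[ℝ] ℝ

namespace CoupledForms

variable (F : CoupledForms D G Z)

/-- The nonlinear coupled problem. -/
def IsSolution (s : D × G × Z) : Prop :=
  ∀ t : D × G × Z,
    F.a s.1 t.1 + F.n s.1 s.1 t.1 + F.b s.2.1 t.1 + F.q s.2.2 t.1 = F.L t.1 ∧
    F.b t.2.1 s.1 = 0 ∧
    F.e s.2.2 t.2.2 + F.h s.1 s.2.2 t.2.2 = F.φ t.2.2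

/-- The linear problem without the transport terms. -/
def IsStokes (s : D × G × Z) : Prop :=
  ∀ t : D × G × Z,
    F.a s.1 t.1 + F.b s.2.1 t.1 + F.q s.2.2 t.1 = F.L t.1 ∧
    F.b t.2.1 s.1 = 0 ∧
    F.e s.2.2 t.2.2 = F.φ t.2.2

/-- The linear problem with a given transport field `w`. -/
def IsPicard (w : D) (s : D × G × Z) : Prop :=
  ∀ t : D × G × Z,
    F.a s.1 t.1 + F.n w s.1 t.1 + F.b s.2.1 t.1 + F.q s.2.2 t.1 = F.L t.1 ∧
    F.b t.2.1 s.1 = 0 ∧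
    F.e s.2.2 t.2.2 + F.h w s.2.2 t.2.2 = F.φ t.2.2

/-- The Newton step from `o` to `s`. -/
def IsNewton (o s : D × G × Z) : Prop :=
  ∀ t : D × G × Z,
    F.a s.1 t.1 + F.n o.1 s.1 t.1 + F.n s.1 o.1 t.1 - F.n o.1 o.1 t.1 +
      F.b s.2.1 t.1 + F.q s.2.2 t.1 = F.L t.1 ∧
    F.b t.2.1 s.1 = 0 ∧
    F.e s.2.2 t.2.2 + F.h o.1 s.2.2 t.2.2 + F.h s.1 o.2.2 t.2.2 -
      F.h o.1 o.2.2 t.2.2 = F.φ t.2.2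

/-- Coercivity, continuity and inf-sup estimates for the forms of a coupled problem. -/
structure Estimates (pD : Seminorm ℝ D) (pG : G → ℝ) (pZ : Seminorm ℝ Z)
    (c M l lq lL lφ β : ℝ) : Prop where
  pD_def : ∀ x, pD x = 0 → x = 0
  pG_def : ∀ g, pG g = 0 → g = 0
  pG_nonneg : ∀ g, 0 ≤ pG g
  pZ_def : ∀ z, pZ z = 0 → z = 0
  c_pos : 0 < c
  β_pos : 0 < β
  M_nonneg : 0 ≤ M
  l_nonneg : 0 ≤ l
  lq_nonneg : 0 ≤ lq
  lL_nonneg : 0 ≤ lL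
  lφ_nonneg : 0 ≤ lφ
  coercive : ∀ x, (∀ g, F.b g x = 0) → c * pD x ^ 2 ≤ F.a x x
  a_le : ∀ x y, |F.a x y| ≤ M * pD x * pD y
  n_self : ∀ x y, F.n x y y = 0
  n_le : ∀ x y z, |F.n x y z| ≤ l * pD x * pD y * pD z
  h_self : ∀ x z, F.h x z z = 0
  h_le : ∀ x z r, |F.h x z r| ≤ l * pD x * pZ z * pZ r
  e_self : ∀ z, F.e z z = pZ z ^ 2
  q_le : ∀ z x, |F.q z x| ≤ lq * pZ z * pD x
  L_le : ∀ x, F.L x ≤ lL * pD x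
  φ_le : ∀ z, F.φ z ≤ lφ * pZ z
  infsup : ∀ g m, 0 ≤ m → (∀ x, F.b g x ≤ m * pD x) → β * pG g ≤ m

namespace Estimates

variable {F} {pD : Seminorm ℝ D} {pG : G → ℝ} {pZ : Seminorm ℝ Z} {c M l lq lL lφ β : ℝ}
  (E : F.Estimates pD pG pZ c M l lq lL lφ β)

include E

/-- The common energy argument: coercivity on the kernel of b, the identity for e, and cancellation
of one factor of the seminorm. All later bounds feed it a right-hand side A, B. -/
theorem le_of_test {x : D} {z : Z} {A B : ℝ} (hA : 0 ≤ A) (hB : 0 ≤ B) (hx : ∀ g, F.b g x = 0)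
    (h1 : F.a x x + F.q z x ≤ A * pD x) (h2 : F.e z z ≤ B * pZ z) :
    pZ z ≤ B ∧ c * pD x ≤ A + lq * pZ z := by
  have hz0 : 0 ≤ pZ z := apply_nonneg pZ z
  have hx0 : 0 ≤ pD x := apply_nonneg pD x
  have hqz := mul_nonneg E.lq_nonneg hz0
  constructor
  · rw [E.e_self] at h2
    by_contra! hlt
    nlinarith
  · have h3 := E.coercive x hx
    have h4 := neg_le_of_abs_le (E.q_le z x)
    by_contra! hlt
    -- When the seminorm of x vanishes nothing can be cancelled, but the bound holds since its
    -- right-hand side is nonnegative.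
    rcases hx0.eq_or_lt with h | h
    · rw [← h] at hlt
      linarith
    · nlinarith

/-- Eliminating z by the third equation costs a factor ν, so the momentum equation keeps the
coercivity constant c - μ - lq·ν. Here μ is the coercivity lost in a, and ν measures the coupling of
x into the heat equation. Once x and z vanish, so does b g, and the inf-sup condition with m = 0
kills g. -/
theorem homogeneous_eq_zero (a : D →ₗ[ℝ] D →ₗ[ℝ] ℝ) (e : Z →ₗ[ℝ] Z →ₗ[ℝ] ℝ)
    (k : D →ₗ[ℝ] Z →ₗ[ℝ] ℝ) {μ ν : ℝ} (hν : 0 ≤ ν)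
    (ha : ∀ x, F.a x x - μ * pD x ^ 2 ≤ a x x) (he : ∀ z, e z z = F.e z z)
    (hk : ∀ x z, |k x z| ≤ ν * pD x * pZ z) (hμν : μ + lq * ν < c) (x : D) (g : G) (z : Z)
    (h1 : ∀ y, a x y + F.b g y + F.q z y = 0) (h2 : ∀ g', F.b g' x = 0)
    (h3 : ∀ r, e z r + k x r = 0) : x = 0 ∧ g = 0 ∧ z = 0 := by
  have hz0 : 0 ≤ pZ z := apply_nonneg pZ z
  have hx0 : 0 ≤ pD x := apply_nonneg pD x
  have hz : pZ z ≤ ν * pD x := by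
    have h4 := h3 z
    rw [he, E.e_self] at h4
    have h5 := neg_le_of_abs_le (hk x z)
    have h6 := mul_nonneg hν hx0
    by_contra! hlt
    nlinarith
  have hx : x = 0 := by
    apply E.pD_def
    have h4 := h1 x
    rw [h2, add_zero] at h4
    have h5 := neg_le_of_abs_le (E.q_le z x)
    have h6 := E.coercive x h2
    have h7 := ha x
    have h8 : lq * pZ z * pD x ≤ lq * (ν * pD x) * pD x := by
      gcongr
      exact E.lq_nonneg
    have h9 : (c - (μ + lq * ν)) * pD x ^ 2 ≤ 0 := by nlinarith
    have h10 : pD x ^ 2 ≤ 0 := by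
      by_contra! hlt
      nlinarith
    exact pow_eq_zero_iff two_ne_zero |>.1 (le_antisymm h10 (sq_nonneg _))
  have hz : z = 0 := by
    apply E.pZ_def
    rw [hx, map_zero, mul_zero] at hz
    exact le_antisymm hz hz0
  refine ⟨hx, ?_, hz⟩
  apply E.pG_def
  have h4 := E.infsup g 0 le_rfl fun y => by
    have := h1 y
    rw [hx, hz] at this
    simp only [map_zero, LinearMap.zero_apply, zero_add, add_zero] at this
    rw [this, zero_mul]
  have h5 := E.pG_nonneg g
  have h6 := E.β_pos
  by_contra h7
  have : 0 < pG g := lt_of_le_of_ne h5 (Ne.symm h7)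
  nlinarith

section Solvability

variable [FiniteDimensional ℝ D] [FiniteDimensional ℝ G] [FiniteDimensional ℝ Z]

theorem exists_unique_picard (w : D) : ∃ s, ∀ y, F.IsPicard w y ↔ y = s := by
  obtain ⟨s, hs⟩ := exists_unique_linearProblem (F.a + F.n w) F.b F.q (F.e + F.h w) 0
    (E.homogeneous_eq_zero (F.a + F.n w) (F.e + F.h w) 0 (μ := 0) (ν := 0) le_rfl
      (fun x => by simp [E.n_self]) (fun z => by simp [E.h_self]) (fun x z => by simp)
      (by simpa using E.c_pos)) F.L F.φ
  refine ⟨s, fun y => ?_⟩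
  rw [← hs y]
  simp only [IsPicard, LinearMap.add_apply, LinearMap.zero_apply, add_zero]

/-- Only the terms with the old iterate in the second slot of n and h survive testing. They give μ =
(4/3)lR and lq·ν ≤ (4/3)c·lR, with sum below (4/9)c. The terms quadratic in the old iterate are data
and move to the right-hand side. -/
theorem exists_unique_newton {o : D × G × Z} {R : ℝ} (hR : c * R = lL + lq * lφ)
    (hσ : l * R + c * (l * R) < c * (1 / 3)) (hx : pD o.1 ≤ 4 / 3 * R)
    (hz : pZ o.2.2 ≤ 4 / 3 * lφ) : ∃ s, ∀ y, F.IsNewton o y ↔ y = s := by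
  have hl := E.l_nonneg
  have hlq := E.lq_nonneg
  have hlφ := E.lφ_nonneg
  have hc := E.c_pos
  obtain ⟨s, hs⟩ := exists_unique_linearProblem (F.a + F.n o.1 + F.n.flip o.1) F.b F.q
    (F.e + F.h o.1) (F.h.flip o.2.2)
    (E.homogeneous_eq_zero _ _ _ (μ := l * (4 / 3 * R)) (ν := l * (4 / 3 * lφ)) (by positivity)
      (fun x => by
        simp only [LinearMap.add_apply, LinearMap.flip_apply, E.n_self, add_zero]
        have h1 := neg_le_of_abs_le (E.n_le x o.1 x)
        have h2 : l * pD x * pD o.1 * pD x ≤ l * pD x * (4 / 3 * R) * pD x := by gcongr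
        linarith)
      (fun z => by simp [E.h_self])
      (fun x z => by
        simp only [LinearMap.flip_apply]
        have h1 := E.h_le x o.2.2 z
        have h2 : l * pD x * pZ o.2.2 * pZ z ≤ l * pD x * (4 / 3 * lφ) * pZ z := by gcongr
        linarith)
      (by
        have h1 : l * (lq * lφ) ≤ l * (c * R) :=
          mul_le_mul_of_nonneg_left (by linarith [E.lL_nonneg]) hl
        linarith)) (F.L + F.n o.1 o.1) (F.φ + F.h o.1 o.2.2)
  refine ⟨s, fun y => ?_⟩
  rw [← hs y]
  refine forall_congr' fun t => ?_
  simp only [LinearMap.add_apply, LinearMap.flip_apply]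
  refine and_congr ?_ (and_congr Iff.rfl ?_)
  · constructor <;> intro h <;> linarith
  · constructor <;> intro h <;> linarith

theorem exists_unique_stokes : ∃ s, ∀ y, F.IsStokes y ↔ y = s := by
  obtain ⟨s, hs⟩ := E.exists_unique_picard 0
  refine ⟨s, fun y => ?_⟩
  rw [← hs y]
  simp only [IsPicard, IsStokes, map_zero, LinearMap.zero_apply, add_zero]

end Solvability

theorem picard_bound {w : D} {s : D × G × Z} (hs : F.IsPicard w s) {R : ℝ}
    (hR : c * R = lL + lq * lφ) : pD s.1 ≤ R ∧ pZ s.2.2 ≤ lφ := by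
  have hk : ∀ g, F.b g s.1 = 0 := fun g => (hs (0, g, 0)).2.1
  obtain ⟨h1, -, h3⟩ := hs s
  rw [E.n_self, hk] at h1
  rw [E.h_self] at h3
  obtain ⟨h4, h5⟩ := E.le_of_test (x := s.1) (z := s.2.2) E.lL_nonneg E.lφ_nonneg hk
    (by linarith [E.L_le s.1]) (by linarith [E.φ_le s.2.2])
  refine ⟨?_, h4⟩
  have := mul_le_mul_of_nonneg_left h4 E.lq_nonneg
  exact le_of_mul_le_mul_left (by linarith) E.c_pos

/-- In the difference of the two equations the transport by w acts on the difference itself and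
vanishes on testing. What is left is transport of the second solution by w - w', and that solution
is bounded by R and lφ. -/
theorem picard_contraction {w w' : D} {s s' : D × G × Z} (hs : F.IsPicard w s)
    (hs' : F.IsPicard w' s') {R σ : ℝ} (hR : c * R = lL + lq * lφ)
    (hσ : c * σ = l * R + c * (l * R)) : pD (s.1 - s'.1) ≤ σ * pD (w - w') := by
  obtain ⟨hbx, hbz⟩ := E.picard_bound hs' hR
  have hl := E.l_nonneg
  have hlq := E.lq_nonneg
  have hlφ := E.lφ_nonneg
  have hc := E.c_pos
  have hR0 : 0 ≤ R := (apply_nonneg pD _).trans hbx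
  have hw : 0 ≤ pD (w - w') := apply_nonneg _ _
  have hd : 0 ≤ pD (s.1 - s'.1) := apply_nonneg _ _
  have hdz : 0 ≤ pZ (s.2.2 - s'.2.2) := apply_nonneg _ _
  have hk : ∀ g, F.b g (s.1 - s'.1) = 0 := fun g => by
    rw [map_sub, (hs (0, g, 0)).2.1, (hs' (0, g, 0)).2.1, sub_zero]
  obtain ⟨h1, -, h3⟩ := hs (s - s')
  obtain ⟨h1', -, h3'⟩ := hs' (s - s')
  have hn := E.n_self w (s.1 - s'.1)
  have hh := E.h_self w (s.2.2 - s'.2.2)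
  have hb := hk (s.2.1 - s'.2.1)
  -- The splitting is n(w, s) - n(w', s') = n(w, s - s') + n(w - w', s'), and likewise for h.
  have hnl := neg_le_of_abs_le (E.n_le (w - w') s'.1 (s.1 - s'.1))
  have hhl := neg_le_of_abs_le (E.h_le (w - w') s'.2.2 (s.2.2 - s'.2.2))
  have hnl2 : l * pD (w - w') * pD s'.1 * pD (s.1 - s'.1) ≤
    l * pD (w - w') * R * pD (s.1 - s'.1) := by gcongr
  have hhl2 : l * pD (w - w') * pZ s'.2.2 * pZ (s.2.2 - s'.2.2) ≤
    l * pD (w - w') * lφ * pZ (s.2.2 - s'.2.2) := by gcongr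
  simp only [Prod.fst_sub, Prod.snd_sub, map_sub, LinearMap.sub_apply]
    at h1 h1' h3 h3' hn hh hb hnl hhl
  obtain ⟨h4, h5⟩ := E.le_of_test (x := s.1 - s'.1) (z := s.2.2 - s'.2.2)
    (A := l * pD (w - w') * R) (B := l * pD (w - w') * lφ) (by positivity) (by positivity) hk
    (by simp only [map_sub, LinearMap.sub_apply]; linarith)
    (by simp only [map_sub, LinearMap.sub_apply]; linarith)
  have h6 := mul_le_mul_of_nonneg_left h4 hlq
  have h7 : l * pD (w - w') * (lq * lφ) ≤ l * pD (w - w') * (c * R) :=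
    mul_le_mul_of_nonneg_left (by linarith [E.lL_nonneg]) (by positivity)
  have h8 : c * (σ * pD (w - w')) = (l * R + c * (l * R)) * pD (w - w') := by rw [← hσ]; ring
  refine le_of_mul_le_mul_left ?_ hc
  rw [h8]
  linarith

theorem exists_unique_solution [FiniteDimensional ℝ D] [FiniteDimensional ℝ G]
    [FiniteDimensional ℝ Z] {R σ : ℝ} (hR : c * R = lL + lq * lφ)
    (hσ : c * σ = l * R + c * (l * R)) (hσ0 : 0 ≤ σ) (hσ1 : σ < 1) :
    ∃ s, ∀ y, F.IsSolution y ↔ y = s := by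
  choose T hT using E.exists_unique_picard
  have hTs : ∀ w, F.IsPicard w (T w) := fun w => (hT w _).2 rfl
  have hcon : ∀ w w', pD ((T w).1 - (T w').1) ≤ σ * pD (w - w') := fun w w' =>
    E.picard_contraction (hTs w) (hTs w') hR hσ
  obtain ⟨w, hw⟩ := exists_fixedPoint_of_seminorm pD E.pD_def (fun w => (T w).1) hσ0 hσ1 hcon
  -- Solutions are the fixed points of the Picard map, by definition.
  have hiff : ∀ y, F.IsSolution y ↔ F.IsPicard y.1 y := fun y => Iff.rfl
  refine ⟨T w, fun y => ⟨fun hy => ?_, ?_⟩⟩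
  · have hy1 : y = T y.1 := (hT _ _).1 ((hiff y).1 hy)
    have h1 : pD (y.1 - w) ≤ σ * pD (y.1 - w) := by
      have := hcon y.1 w
      rwa [hw, ← hy1] at this
    have h2 : 0 ≤ pD (y.1 - w) := apply_nonneg _ _
    have h3 : y.1 = w := sub_eq_zero.1 (E.pD_def _ (le_antisymm (by nlinarith) h2))
    rw [hy1, h3]
  · rintro rfl
    rw [hiff]
    have := hTs w
    rwa [show (T w).1 = w from hw]

/-- The initial problem differs from the nonlinear one by the transport terms of the exact solution,
of size lR·R and lR·lφ. They act as sources for the error. -/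
theorem stokes_error {s x : D × G × Z} (hs : F.IsSolution s) (hx : F.IsStokes x) {R σ : ℝ}
    (hR : c * R = lL + lq * lφ) (hσ : c * σ = l * R + c * (l * R)) :
    pD (s.1 - x.1) ≤ σ * R ∧ pZ (s.2.2 - x.2.2) ≤ σ * lφ ∧
      β * pG (s.2.1 - x.2.1) ≤ M * pD (s.1 - x.1) + c * (σ * R) := by
  obtain ⟨hbx, hbz⟩ := E.picard_bound (w := s.1) hs hR
  have hl := E.l_nonneg
  have hlq := E.lq_nonneg
  have hlφ := E.lφ_nonneg
  have hc := E.c_pos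
  have hM := E.M_nonneg
  have hR0 : 0 ≤ R := (apply_nonneg pD _).trans hbx
  have hd : 0 ≤ pD (s.1 - x.1) := apply_nonneg _ _
  have hdz : 0 ≤ pZ (s.2.2 - x.2.2) := apply_nonneg _ _
  have hk : ∀ g, F.b g (s.1 - x.1) = 0 := fun g => by
    rw [map_sub, (hs (0, g, 0)).2.1, (hx (0, g, 0)).2.1, sub_zero]
  have hn : ∀ y, |F.n s.1 s.1 y| ≤ l * R * R * pD y := fun y =>
    (E.n_le s.1 s.1 y).trans (by gcongr)
  have hh : ∀ r, |F.h s.1 s.2.2 r| ≤ l * R * lφ * pZ r := fun r =>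
    (E.h_le s.1 s.2.2 r).trans (by gcongr)
  have hlql : lq * lφ ≤ c * R := by linarith [E.lL_nonneg]
  have heq : ∀ y, F.a (s.1 - x.1) y + F.n s.1 s.1 y + F.b (s.2.1 - x.2.1) y +
      F.q (s.2.2 - x.2.2) y = 0 := fun y => by
    have h1 := (hs (y, 0, 0)).1
    have h2 := (hx (y, 0, 0)).1
    simp only [map_sub, LinearMap.sub_apply] at h1 h2 ⊢
    linarith
  have heqz : ∀ r, F.e (s.2.2 - x.2.2) r + F.h s.1 s.2.2 r = 0 := fun r => by
    have h1 := (hs (0, 0, r)).2.2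
    have h2 := (hx (0, 0, r)).2.2
    simp only [map_sub, LinearMap.sub_apply] at h1 h2 ⊢
    linarith
  obtain ⟨h4, h5⟩ := E.le_of_test (x := s.1 - x.1) (z := s.2.2 - x.2.2)
    (A := l * R * R) (B := l * R * lφ) (by positivity) (by positivity) hk
    (by linarith [heq (s.1 - x.1), hk (s.2.1 - x.2.1), neg_le_of_abs_le (hn (s.1 - x.1))])
    (by linarith [heqz (s.2.2 - x.2.2), neg_le_of_abs_le (hh (s.2.2 - x.2.2))])
  have h6 : lq * pZ (s.2.2 - x.2.2) ≤ lq * (l * R * lφ) := mul_le_mul_of_nonneg_left h4 hlq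
  have h7 : l * R * (lq * lφ) ≤ l * R * (c * R) := by gcongr
  have h8 : c * (σ * R) = (l * R + c * (l * R)) * R := by rw [← hσ]; ring
  refine ⟨le_of_mul_le_mul_left (by rw [h8]; linarith) hc, ?_, ?_⟩
  · refine h4.trans (mul_le_mul_of_nonneg_right ?_ hlφ)
    refine le_of_mul_le_mul_left ?_ hc
    rw [hσ]
    have : 0 ≤ l * R := by positivity
    linarith
  · refine E.infsup _ _ (by rw [h8]; positivity) fun y => ?_
    have hy : 0 ≤ pD y := apply_nonneg _ _
    have h9 := neg_le_of_abs_le (E.a_le (s.1 - x.1) y)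
    have h10 := neg_le_of_abs_le (hn y)
    have h11 := neg_le_of_abs_le (E.q_le (s.2.2 - x.2.2) y)
    have h12 := heq y
    have h13 : (l * R * R + lq * pZ (s.2.2 - x.2.2)) * pD y ≤ c * (σ * R) * pD y := by
      gcongr
      rw [h8]
      linarith
    linarith

/-- Here ε is a relative error, measured in units of R for velocity and current and of lφ for the
temperature, so that one number controls both components and the recursion is scalar. -/
theorem newton_error {s o x : D × G × Z} (hs : F.IsSolution s) (hx : F.IsNewton o x) {R σ ε : ℝ}
    (hR : c * R = lL + lq * lφ) (hσ : c * σ = l * R + c * (l * R)) (hσ0 : 0 < σ)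
    (hσ1 : σ < 1 / 3) (hox : pD o.1 ≤ 4 / 3 * R) (hoz : pZ o.2.2 ≤ 4 / 3 * lφ) (hε : 0 ≤ ε)
    (hex : pD (s.1 - o.1) ≤ ε * R) (hez : pZ (s.2.2 - o.2.2) ≤ ε * lφ) :
    pD (s.1 - x.1) ≤ 9 / 5 * σ * ε ^ 2 * R ∧ pZ (s.2.2 - x.2.2) ≤ 9 / 5 * σ * ε ^ 2 * lφ ∧
      β * pG (s.2.1 - x.2.1) ≤
        M * pD (s.1 - x.1) + 22 / 9 * c * (9 / 5 * σ * ε ^ 2) * R := by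
  obtain ⟨hbx, hbz⟩ := E.picard_bound (w := s.1) hs hR
  have hl := E.l_nonneg
  have hlq := E.lq_nonneg
  have hlφ := E.lφ_nonneg
  have hc := E.c_pos
  have hM := E.M_nonneg
  have hR0 : 0 ≤ R := (apply_nonneg pD _).trans hbx
  set X := pD (s.1 - x.1) with hX
  set W := pZ (s.2.2 - x.2.2) with hW
  have hd : 0 ≤ X := apply_nonneg _ _
  have hdz : 0 ≤ W := apply_nonneg _ _
  have hk : ∀ g, F.b g (s.1 - x.1) = 0 := fun g => by
    rw [map_sub, (hs (0, g, 0)).2.1, (hx (0, g, 0)).2.1, sub_zero]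
  have hlql : lq * lφ ≤ c * R := by linarith [E.lL_nonneg]
  have hn1 : ∀ y, |F.n o.1 (s.1 - x.1) y| ≤ l * (4 / 3 * R) * X * pD y := fun y =>
    (E.n_le _ _ _).trans (by gcongr)
  have hn2 : ∀ y, |F.n (s.1 - x.1) o.1 y| ≤ l * X * (4 / 3 * R) * pD y := fun y =>
    (E.n_le _ _ _).trans (by gcongr)
  have hn3 : ∀ y, |F.n (s.1 - o.1) (s.1 - o.1) y| ≤ l * (ε * R) * (ε * R) * pD y := fun y =>
    (E.n_le _ _ _).trans (by gcongr)
  have hh2 : ∀ r, |F.h (s.1 - x.1) o.2.2 r| ≤ l * X * (4 / 3 * lφ) * pZ r := fun y =>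
    (E.h_le _ _ _).trans (by gcongr)
  have hh3 : ∀ r, |F.h (s.1 - o.1) (s.2.2 - o.2.2) r| ≤ l * (ε * R) * (ε * lφ) * pZ r := fun y =>
    (E.h_le _ _ _).trans (by gcongr)
  -- Taylor expansion of the quadratic term at o: n(s,s) - n(o,x) - n(x,o) + n(o,o) = n(o,s-x) +
  -- n(s-x,o) + n(s-o,s-o). The last term is the source of the quadratic convergence.
  have heq : ∀ y, F.a (s.1 - x.1) y + F.n o.1 (s.1 - x.1) y + F.n (s.1 - x.1) o.1 y +
      F.n (s.1 - o.1) (s.1 - o.1) y + F.b (s.2.1 - x.2.1) y +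
      F.q (s.2.2 - x.2.2) y = 0 := fun y => by
    have h1 := (hs (y, 0, 0)).1
    have h2 := (hx (y, 0, 0)).1
    simp only [map_sub, LinearMap.sub_apply] at h1 h2 ⊢
    linarith
  have heqz : ∀ r, F.e (s.2.2 - x.2.2) r + F.h o.1 (s.2.2 - x.2.2) r + F.h (s.1 - x.1) o.2.2 r +
      F.h (s.1 - o.1) (s.2.2 - o.2.2) r = 0 := fun r => by
    have h1 := (hs (0, 0, r)).2.2
    have h2 := (hx (0, 0, r)).2.2
    simp only [map_sub, LinearMap.sub_apply] at h1 h2 ⊢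
    linarith
  obtain ⟨h4, h5⟩ := E.le_of_test (x := s.1 - x.1) (z := s.2.2 - x.2.2)
    (A := l * X * (4 / 3 * R) + l * (ε * R) * (ε * R))
    (B := l * X * (4 / 3 * lφ) + l * (ε * R) * (ε * lφ)) (by positivity) (by positivity) hk
    (by linarith [heq (s.1 - x.1), hk (s.2.1 - x.2.1), neg_le_of_abs_le (hn2 (s.1 - x.1)),
          neg_le_of_abs_le (hn3 (s.1 - x.1)), E.n_self o.1 (s.1 - x.1)])
    (by linarith [heqz (s.2.2 - x.2.2), neg_le_of_abs_le (hh2 (s.2.2 - x.2.2)),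
          neg_le_of_abs_le (hh3 (s.2.2 - x.2.2)), E.h_self o.1 (s.2.2 - x.2.2)])
  rw [← hX, ← hW] at h5
  rw [← hW] at h4
  have h6 := mul_le_mul_of_nonneg_left h4 hlq
  have h7 : l * X * (lq * lφ) ≤ l * X * (c * R) := by gcongr
  have h7' : l * (ε ^ 2 * R) * (lq * lφ) ≤ l * (ε ^ 2 * R) * (c * R) := by gcongr
  have hX1 : X ≤ 4 / 3 * σ * X + ε ^ 2 * σ * R := by
    refine le_of_mul_le_mul_left ?_ hc
    have : c * (4 / 3 * σ * X + ε ^ 2 * σ * R) =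
      (l * R + c * (l * R)) * (4 / 3 * X + ε ^ 2 * R) := by rw [← hσ]; ring
    rw [this]
    linarith
  -- Absorb (4/3)σX ≤ (4/9)X on the left; 9/5 is the inverse of 5/9.
  have hX2 : X ≤ 9 / 5 * σ * ε ^ 2 * R := by
    have : σ * X ≤ 1 / 3 * X := by gcongr
    linarith
  have hlR : 0 ≤ l * R := by positivity
  have hlRσ : l * R ≤ σ := by
    refine le_of_mul_le_mul_left ?_ hc
    linarith
  have hlRσ2 : l * R ≤ c * σ := by
    have := mul_nonneg hc.le hlR
    linarith
  -- The same 9/5 reappears: with X ≤ (9/5)(1/3)ε²R the coupling term contributes (3/5)(4/3) = 4/5,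
  -- and the remainder contributes 1.
  have hW2 : W ≤ 9 / 5 * σ * ε ^ 2 * lφ := by
    have h8 : l * X * (4 / 3 * lφ) ≤ l * (9 / 5 * (1 / 3) * ε ^ 2 * R) * (4 / 3 * lφ) := by
      gcongr
      refine hX2.trans ?_
      gcongr
    have h9 : l * R * (9 / 5 * ε ^ 2 * lφ) ≤ σ * (9 / 5 * ε ^ 2 * lφ) := by gcongr
    linarith
  refine ⟨hX2, hW2, E.infsup _ _ (by positivity) fun y => ?_⟩
  have hy : 0 ≤ pD y := apply_nonneg _ _
  have h9 := neg_le_of_abs_le (E.a_le (s.1 - x.1) y)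
  have h10 := neg_le_of_abs_le (hn1 y)
  have h10' := neg_le_of_abs_le (hn2 y)
  have h10'' := neg_le_of_abs_le (hn3 y)
  have h11 := neg_le_of_abs_le (E.q_le (s.2.2 - x.2.2) y)
  have h12 := heq y
  -- In units of c·(9/5)σε²R, the two linearised terms give 8/9, the remainder 5/9 and buoyancy 1,
  -- which add up to 22/9.
  have h13 : l * R * (8 / 3 * X) ≤ c * σ * (8 / 3 * X) := by gcongr
  have h14 : c * σ * (8 / 3 * X) ≤ c * (1 / 3) * (8 / 3 * (9 / 5 * σ * ε ^ 2 * R)) := by gcongr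
  have h15 : l * R * (ε ^ 2 * R) ≤ c * σ * (ε ^ 2 * R) := by gcongr
  have h16 : lq * W ≤ lq * (9 / 5 * σ * ε ^ 2 * lφ) := by gcongr
  have h17 : (9 / 5 * σ * ε ^ 2) * (lq * lφ) ≤ (9 / 5 * σ * ε ^ 2) * (c * R) := by gcongr
  have h18 : (l * (4 / 3 * R) * X + l * X * (4 / 3 * R) + l * (ε * R) * (ε * R) + lq * W) * pD y ≤
      22 / 9 * c * (9 / 5 * σ * ε ^ 2) * R * pD y := by
    gcongr
    linarith
  rw [← hX] at h9
  rw [← hW] at h11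
  linarith

/-- Well-posedness and quadratic convergence of the Newton iteration. -/
theorem newton_convergence [FiniteDimensional ℝ D] [FiniteDimensional ℝ G]
    [FiniteDimensional ℝ Z] {R σ : ℝ} (hR : c * R = lL + lq * lφ)
    (hσ : c * σ = l * R + c * (l * R)) (hσ0 : 0 < σ) (hσ1 : σ < 1 / 3) :
    ∃ (s : D × G × Z) (x : ℕ → D × G × Z),
      (∀ y, F.IsSolution y ↔ y = s) ∧ (∀ y, F.IsStokes y ↔ y = x 0) ∧
      (∀ n y, F.IsNewton (x n) y ↔ y = x (n + 1)) ∧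
      ∀ n, pD (x n).1 ≤ 4 / 3 * R ∧ pZ (x n).2.2 ≤ 4 / 3 * lφ ∧
        pD (s.1 - (x n).1) ≤ (9 / 5 * σ) ^ (2 ^ n - 1) * R ∧
        pZ (s.2.2 - (x n).2.2) ≤ (9 / 5 * σ) ^ (2 ^ n - 1) * lφ ∧
        β * pG (s.2.1 - (x n).2.1) ≤ (M + 22 / 9 * c) * (9 / 5 * σ) ^ (2 ^ n - 1) * R := by
  obtain ⟨s, hs⟩ := E.exists_unique_solution hR hσ hσ0.le (hσ1.trans (by norm_num))
  obtain ⟨x0, hx0⟩ := E.exists_unique_stokes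
  have hsol : F.IsSolution s := (hs s).2 rfl
  obtain ⟨hbx, hbz⟩ := E.picard_bound (w := s.1) hsol hR
  have hc := E.c_pos
  have hM := E.M_nonneg
  have hlφ := E.lφ_nonneg
  have hR0 : 0 ≤ R := (apply_nonneg pD _).trans hbx
  -- The invariant set: relative distance at most σ from the solution. Since σ < 1/3, its members
  -- satisfy the bounds with 4/3 needed for the next Newton step.
  let S := {o : D × G × Z // pD (s.1 - o.1) ≤ σ * R ∧ pZ (s.2.2 - o.2.2) ≤ σ * lφ}
  have hS : ∀ o : S, pD o.1.1 ≤ 4 / 3 * R ∧ pZ o.1.2.2 ≤ 4 / 3 * lφ := fun o => by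
    have h1 := map_sub_le_add pD s.1 (s.1 - o.1.1)
    have h2 := map_sub_le_add pZ s.2.2 (s.2.2 - o.1.2.2)
    rw [sub_sub_cancel] at h1 h2
    have h3 : σ * R ≤ 1 / 3 * R := by gcongr
    have h4 : σ * lφ ≤ 1 / 3 * lφ := by gcongr
    constructor
    · linarith [o.2.1]
    · linarith [o.2.2]
  have hstep : ∀ o : S, ∃ y : S, ∀ z, F.IsNewton o.1 z ↔ z = y.1 := fun o => by
    obtain ⟨y, hy⟩ := E.exists_unique_newton hR (by rw [← hσ]; gcongr) (hS o).1 (hS o).2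
    obtain ⟨h1, h2, -⟩ := E.newton_error hsol ((hy y).2 rfl) hR hσ hσ0 hσ1 (hS o).1 (hS o).2
      hσ0.le o.2.1 o.2.2
    -- Invariance of the set: the step maps ε = σ to (9/5)σ³, and σ² < 1/9.
    have h3 : 9 / 5 * σ * σ ^ 2 ≤ σ := by nlinarith [mul_pos hσ0 hσ0]
    exact ⟨⟨y, h1.trans (by gcongr), h2.trans (by gcongr)⟩, hy⟩
  choose N hN using hstep
  obtain ⟨he1, he2, he3⟩ := E.stokes_error hsol ((hx0 x0).2 rfl) hR hσ
  let x : ℕ → S := fun n => Nat.rec ⟨x0, he1, he2⟩ (fun _ o => N o) n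
  have hxs : ∀ n, x (n + 1) = N (x n) := fun n => rfl
  refine ⟨s, fun n => (x n).1, hs, hx0, fun n y => hN (x n) y, fun n => ?_⟩
  refine ⟨(hS (x n)).1, (hS (x n)).2, ?_⟩
  -- On exponents, 2(2^n - 1) + 1 = 2^(n+1) - 1; the truncated subtraction is harmless because 2^n ≥
  -- 1.
  have hpow : ∀ n, 9 / 5 * σ * ((9 / 5 * σ) ^ (2 ^ n - 1)) ^ 2 = (9 / 5 * σ) ^ (2 ^ (n + 1) - 1) := by
    intro n
    rw [← pow_mul, ← pow_succ']
    congr 1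
    have := Nat.one_le_two_pow (n := n)
    rw [pow_succ]
    omega
  have herr : ∀ n, pD (s.1 - (x n).1.1) ≤ (9 / 5 * σ) ^ (2 ^ n - 1) * R ∧
      pZ (s.2.2 - (x n).1.2.2) ≤ (9 / 5 * σ) ^ (2 ^ n - 1) * lφ := by
    intro n
    induction n with
    | zero =>
      -- At n = 0 the exponent is 0, so the sharper initial error σ is relaxed to 1.
      have h3 : σ * R ≤ 1 * R := by gcongr; linarith
      have h4 : σ * lφ ≤ 1 * lφ := by gcongr; linarith
      simp only [pow_zero, Nat.sub_self]
      exact ⟨he1.trans h3, he2.trans h4⟩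
    | succ n ih =>
      obtain ⟨h1, h2, -⟩ := E.newton_error hsol ((hN (x n) _).2 rfl) hR hσ hσ0 hσ1 (hS (x n)).1
        (hS (x n)).2 (by positivity) ih.1 ih.2
      rw [hpow] at h1 h2
      exact ⟨h1, h2⟩
  refine ⟨(herr n).1, (herr n).2, ?_⟩
  have hMe := mul_le_mul_of_nonneg_left (herr n).1 hM
  suffices h : β * pG (s.2.1 - (x n).1.2.1) ≤
      M * pD (s.1 - (x n).1.1) + 22 / 9 * c * (9 / 5 * σ) ^ (2 ^ n - 1) * R by linarith
  cases n with
  | zero =>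
    refine he3.trans (add_le_add le_rfl ?_)
    have : c * (σ * R) ≤ c * (22 / 9 * R) := by gcongr; linarith
    simp only [pow_zero, Nat.sub_self, mul_one]
    linarith
  | succ n =>
    obtain ⟨-, -, h3⟩ := E.newton_error hsol ((hN (x n) _).2 rfl) hR hσ hσ0 hσ1 (hS (x n)).1
      (hS (x n)).2 (by positivity) (herr n).1 (herr n).2
    rwa [hpow] at h3

end Estimates

end CoupledForms

end LinearProblem

/-! ### Hölder estimates for integrals of products -/

section Holder

variable {α E F G : Type*} {m : MeasurableSpace α} {μ : Measure α} [NormedAddCommGroup E]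
  [NormedAddCommGroup F] [NormedAddCommGroup G]

theorem integrable_and_abs_integral_le {f : α → E} {g : α → F} {k : α → ℝ} {p q : ENNReal}
    [ENNReal.HolderTriple p q 1] (hf : MemLp f p μ) (hg : MemLp g q μ)
    (hk : AEStronglyMeasurable k μ) (h : ∀ x, |k x| ≤ ‖f x‖ * ‖g x‖) :
    Integrable k μ ∧ |∫ x, k x ∂μ| ≤ (eLpNorm f p μ).toReal * (eLpNorm g q μ).toReal := by
  have h1 : MemLp (fun x => ‖f x‖ * ‖g x‖) 1 μ := MemLp.mul' hg.norm hf.norm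
  have h2 : eLpNorm (fun x => ‖f x‖ * ‖g x‖) 1 μ ≤ eLpNorm f p μ * eLpNorm g q μ := by
    have := eLpNorm_smul_le_mul_eLpNorm (r := 1) (p := p) (q := q) hg.norm.1 hf.norm.1
    rwa [eLpNorm_norm, eLpNorm_norm] at this
  have h3 : ∀ x, ‖k x‖ ≤ ‖‖f x‖ * ‖g x‖‖ := fun x => by
    rw [Real.norm_eq_abs, Real.norm_of_nonneg (by positivity)]
    exact h x
  have hfin : eLpNorm f p μ * eLpNorm g q μ ≠ ⊤ :=
    ENNReal.mul_ne_top hf.eLpNorm_ne_top hg.eLpNorm_ne_top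
  refine ⟨memLp_one_iff_integrable.1 (h1.mono hk (.of_forall h3)), ?_⟩
  rw [← ENNReal.toReal_mul, ← Real.norm_eq_abs]
  have h4 : ‖∫ x, k x ∂μ‖ₑ ≤ eLpNorm f p μ * eLpNorm g q μ :=
    (enorm_integral_le_lintegral_enorm k).trans
      (eLpNorm_one_eq_lintegral_enorm.symm.le.trans ((eLpNorm_mono h3).trans h2))
  have h5 := ENNReal.toReal_mono hfin h4
  rwa [toReal_enorm] at h5

/-- The outer factors are merged into one L² function, then paired with the middle one. The
exponents used are (4, 2, 4) for transport and (3, 2, 6) for the magnetic coupling. -/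
theorem integrable_and_abs_integral_le₃ {f : α → E} {g : α → F} {w : α → G} {k : α → ℝ}
    {p r : ENNReal} [ENNReal.HolderTriple p r 2] (hf : MemLp f p μ) (hg : MemLp g 2 μ)
    (hw : MemLp w r μ) (hk : AEStronglyMeasurable k μ) (h : ∀ x, |k x| ≤ ‖f x‖ * ‖g x‖ * ‖w x‖) :
    Integrable k μ ∧ |∫ x, k x ∂μ| ≤
      (eLpNorm f p μ).toReal * (eLpNorm g 2 μ).toReal * (eLpNorm w r μ).toReal := by
  have h1 : MemLp (fun x => ‖f x‖ * ‖w x‖) 2 μ := MemLp.mul' hw.norm hf.norm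
  have h2 : eLpNorm (fun x => ‖f x‖ * ‖w x‖) 2 μ ≤ eLpNorm f p μ * eLpNorm w r μ := by
    have := eLpNorm_smul_le_mul_eLpNorm (r := 2) (p := p) (q := r) hw.norm.1 hf.norm.1
    rwa [eLpNorm_norm, eLpNorm_norm] at this
  have h3 := ENNReal.toReal_mono
    (ENNReal.mul_ne_top hf.eLpNorm_ne_top hw.eLpNorm_ne_top) h2
  rw [ENNReal.toReal_mul] at h3
  obtain ⟨h4, h5⟩ := integrable_and_abs_integral_le h1 hg hk fun x => by
    rw [Real.norm_of_nonneg (by positivity)]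
    exact (h x).trans_eq (by ring)
  refine ⟨h4, h5.trans ?_⟩
  calc _ ≤ _ := mul_le_mul_of_nonneg_right h3 ENNReal.toReal_nonneg
    _ = _ := by ring

instance : ENNReal.HolderTriple 4 4 2 where
  inv_add_inv_eq_inv := by
    rw [← ENNReal.toReal_eq_toReal_iff' (by simp) (by simp),
      ENNReal.toReal_add (by simp) (by simp)]
    simp only [ENNReal.toReal_inv, ENNReal.toReal_ofNat]
    norm_num

instance : ENNReal.HolderTriple 3 6 2 where
  inv_add_inv_eq_inv := by
    rw [← ENNReal.toReal_eq_toReal_iff' (by simp) (by simp),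
      ENNReal.toReal_add (by simp) (by simp)]
    simp only [ENNReal.toReal_inv, ENNReal.toReal_ofNat]
    norm_num

end Holder

/-! ### Linearity of integrals whose integrands are linear almost everywhere -/

section AELinear

variable {α : Type*} {m : MeasurableSpace α} {μ : Measure α} {U V W E F : Type*}
  [AddCommMonoid U] [Module ℝ U] [AddCommMonoid V] [Module ℝ V] [AddCommMonoid W] [Module ℝ W]
  [AddCommMonoid E] [Module ℝ E] [AddCommMonoid F] [Module ℝ F]

/-- A map into functions that is linear up to null sets. -/
structure AELinear (μ : Measure α) (f : U → α → E) : Prop where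
  map_add : ∀ u v, ∀ᵐ x ∂μ, f (u + v) x = f u x + f v x
  map_smul : ∀ (c : ℝ) (u), ∀ᵐ x ∂μ, f (c • u) x = c • f u x

/-- Representatives of `Lp` classes add only off a null set. Isolating that in f leaves the rest of
an integrand as an exactly linear map at each point. -/
theorem AELinear.comp {f : U → α → E} (hf : AELinear μ f) (T : α → E → F)
    (hT : ∀ x, IsLinearMap ℝ (T x)) : AELinear μ fun u x => T x (f u x) where
  map_add u v := (hf.map_add u v).mono fun x hx => by rw [hx, (hT x).map_add]
  map_smul c u := (hf.map_smul c u).mono fun x hx => by rw [hx, (hT x).map_smul]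

theorem AELinear.isLinearMap_integral {f : U → α → ℝ} (hf : AELinear μ f)
    (hi : ∀ u, Integrable (f u) μ) : IsLinearMap ℝ fun u => ∫ x, f u x ∂μ where
  map_add u v := by
    rw [integral_congr_ae (hf.map_add u v), integral_add (hi u) (hi v)]
  map_smul c u := by
    rw [integral_congr_ae (hf.map_smul c u), integral_smul]

theorem aeLinear_coe_Lp {F : Type*} [NormedAddCommGroup F] [NormedSpace ℝ F] {p : ENNReal}
    (f : U →ₗ[ℝ] Lp F p μ) : AELinear μ fun u x => f u x where
  map_add u v := by
    rw [map_add]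
    exact Lp.coeFn_add _ _
  map_smul c u := by
    rw [_root_.map_smul]
    exact Lp.coeFn_smul _ _

theorem AELinear.toLp {ι : Type*} [Finite ι] {F : Type*} [AddCommGroup F] [Module ℝ F]
    {f : ι → U → α → F} (hf : ∀ i, AELinear μ (f i)) :
    AELinear μ fun u x => WithLp.toLp 2 fun i => f i u x where
  map_add u v := by
    filter_upwards [eventually_countable_forall.2 fun i => (hf i).map_add u v] with x hx
    simp only [hx]
    rfl
  map_smul c u := by
    filter_upwards [eventually_countable_forall.2 fun i => (hf i).map_smul c u] with x hx
    simp only [hx]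
    rfl

theorem _root_.IsLinearMap.comp_linearMap {f : U → V} (hf : IsLinearMap ℝ f) (g : W →ₗ[ℝ] U) :
    IsLinearMap ℝ fun w => f (g w) where
  map_add u v := by rw [map_add, hf.map_add]
  map_smul c u := by rw [_root_.map_smul, hf.map_smul]

theorem _root_.IsLinearMap.comp_fst {f : U → E} (hf : IsLinearMap ℝ f) :
    IsLinearMap ℝ fun p : U × V => f p.1 where
  map_add u v := hf.map_add u.1 v.1
  map_smul c u := hf.map_smul c u.1

theorem _root_.IsLinearMap.comp_snd {f : V → E} (hf : IsLinearMap ℝ f) :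
    IsLinearMap ℝ fun p : U × V => f p.2 where
  map_add u v := hf.map_add u.2 v.2
  map_smul c u := hf.map_smul c u.2

theorem isLinearMap_inner_left {F : Type*} [NormedAddCommGroup F] [InnerProductSpace ℝ F] (y : F) :
    IsLinearMap ℝ fun x => inner ℝ x y :=
  ⟨fun _ _ => inner_add_left _ _ _, fun _ _ => real_inner_smul_left _ _ _⟩

theorem isLinearMap_inner_right {F : Type*} [NormedAddCommGroup F] [InnerProductSpace ℝ F]
    (y : F) : IsLinearMap ℝ fun x => inner ℝ y x :=
  ⟨fun _ _ => inner_add_right _ _ _, fun _ _ => real_inner_smul_right _ _ _⟩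

theorem _root_.IsLinearMap.const_mul {f : U → ℝ} (hf : IsLinearMap ℝ f) (c : ℝ) :
    IsLinearMap ℝ fun u => c * f u where
  map_add u v := by rw [hf.map_add, mul_add]
  map_smul r u := by rw [hf.map_smul, smul_eq_mul, smul_eq_mul, mul_left_comm]

theorem _root_.IsLinearMap.add' {f g : U → ℝ} (hf : IsLinearMap ℝ f) (hg : IsLinearMap ℝ g) :
    IsLinearMap ℝ fun u => f u + g u where
  map_add u v := by rw [hf.map_add, hg.map_add]; ring
  map_smul r u := by rw [hf.map_smul, hg.map_smul, smul_add]

theorem _root_.IsLinearMap.sub' {f g : U → ℝ} (hf : IsLinearMap ℝ f) (hg : IsLinearMap ℝ g) :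
    IsLinearMap ℝ fun u => f u - g u where
  map_add u v := by rw [hf.map_add, hg.map_add]; ring
  map_smul r u := by rw [hf.map_smul, hg.map_smul, smul_sub]

/-- A bilinear form from its linearity in each argument. -/
def bilinOfIsLinear (f : U → V → ℝ) (h1 : ∀ v, IsLinearMap ℝ fun u => f u v)
    (h2 : ∀ u, IsLinearMap ℝ (f u)) : U →ₗ[ℝ] V →ₗ[ℝ] ℝ :=
  LinearMap.mk₂ ℝ f (fun u u' v => (h1 v).map_add u u') (fun c u v => (h1 v).map_smul c u)
    (fun u v v' => (h2 u).map_add v v') (fun c u v => (h2 u).map_smul c v)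

/-- A trilinear form from its linearity in each argument. -/
def trilinOfIsLinear (f : U → V → W → ℝ) (h1 : ∀ v w, IsLinearMap ℝ fun u => f u v w)
    (h2 : ∀ u w, IsLinearMap ℝ fun v => f u v w) (h3 : ∀ u v, IsLinearMap ℝ (f u v)) :
    U →ₗ[ℝ] V →ₗ[ℝ] W →ₗ[ℝ] ℝ where
  toFun u := bilinOfIsLinear (f u) (h2 u) (h3 u)
  map_add' u u' := LinearMap.ext₂ fun v w => (h1 v w).map_add u u'
  map_smul' c u := LinearMap.ext₂ fun v w => (h1 v w).map_smul c u

end AELinear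

/-! ### Pointwise bounds for the integrands -/

section Pointwise

variable {d : ℕ}

local notation "𝔼" => EuclideanSpace ℝ (Fin d)

/-- Cauchy–Schwarz in each row of A, then over the rows. The norm of A is the Frobenius norm, so no
constant depending on d appears. -/
theorem abs_sum_inner_mul_le (a w : 𝔼) (A : PiLp 2 fun _ : Fin d => 𝔼) :
    |∑ i, (∑ j, a j * A i j) * w i| ≤ ‖a‖ * ‖A‖ * ‖w‖ := by
  have h1 : ∀ i, |∑ j, a j * A i j| ≤ ‖a‖ * ‖A i‖ := fun i => by
    have := abs_real_inner_le_norm a (A i)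
    rw [PiLp.inner_apply] at this
    simpa [mul_comm] using this
  calc |∑ i, (∑ j, a j * A i j) * w i| ≤ ∑ i, |(∑ j, a j * A i j) * w i| :=
        Finset.abs_sum_le_sum_abs _ _
    _ ≤ ∑ i, ‖a‖ * (‖A i‖ * |w i|) := by
        refine Finset.sum_le_sum fun i _ => ?_
        rw [abs_mul, ← mul_assoc]
        exact mul_le_mul_of_nonneg_right (h1 i) (abs_nonneg _)
    _ = ‖a‖ * ∑ i, ‖A i‖ * |w i| := by rw [Finset.mul_sum]
    _ ≤ ‖a‖ * (‖A‖ * ‖w‖) := by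
        refine mul_le_mul_of_nonneg_left ?_ (norm_nonneg _)
        refine (Real.sum_mul_le_sqrt_mul_sqrt _ _ _).trans_eq ?_
        rw [PiLp.norm_eq_of_L2, EuclideanSpace.norm_eq]
        simp
    _ = ‖a‖ * ‖A‖ * ‖w‖ := by ring

theorem abs_sum_mul_le (a g : 𝔼) (r : ℝ) : |(∑ j, a j * g j) * r| ≤ ‖a‖ * ‖g‖ * ‖r‖ := by
  rw [abs_mul, Real.norm_eq_abs]
  refine mul_le_mul_of_nonneg_right ?_ (abs_nonneg _)
  have := abs_real_inner_le_norm a g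
  rw [PiLp.inner_apply] at this
  simpa [mul_comm] using this

theorem sum_pad_sq (hd : d = 2 ∨ d = 3) (v : 𝔼) : ∑ k, pad v k ^ 2 = ‖v‖ ^ 2 := by
  rw [EuclideanSpace.norm_sq_eq]
  rcases hd with rfl | rfl
  · simp [Fin.sum_univ_three, Fin.sum_univ_two, pad]
  · simp [Fin.sum_univ_three, pad]

theorem pad_add (u v : 𝔼) : pad (u + v) = pad u + pad v := by
  funext k
  by_cases h : (k : ℕ) < d <;> simp [pad, h]

theorem pad_smul (c : ℝ) (v : 𝔼) : pad (c • v) = c • pad v := by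
  funext k
  by_cases h : (k : ℕ) < d <;> simp [pad, h]

/-- Cauchy–Schwarz combined with Lagrange's identity |a × b|² = |a|²|b|² - (a·b)². -/
theorem abs_cross_dot_le (a b c : Fin 3 → ℝ) :
    |dotProduct (crossProduct a b) c| ≤
      √(∑ k, a k ^ 2) * √(∑ k, b k ^ 2) * √(∑ k, c k ^ 2) := by
  rw [← Real.sqrt_mul (by positivity), ← Real.sqrt_mul (by positivity)]
  refine Real.abs_le_sqrt ?_
  have h1 := Finset.sum_mul_sq_le_sq_mul_sq Finset.univ (crossProduct a b) c
  refine h1.trans (mul_le_mul_of_nonneg_right ?_ (by positivity))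
  simp only [cross_apply, Fin.sum_univ_three]
  simp
  nlinarith [sq_nonneg (a 0 * b 0 + a 1 * b 1 + a 2 * b 2)]

theorem abs_cross_pad_le (hd : d = 2 ∨ d = 3) (K v : 𝔼) (b : EuclideanSpace ℝ (Fin 3)) :
    |dotProduct (crossProduct (pad K) b.ofLp) (pad v)| ≤ ‖b‖ * ‖K‖ * ‖v‖ := by
  refine (abs_cross_dot_le _ _ _).trans_eq ?_
  have h3 := EuclideanSpace.norm_eq b
  simp only [Real.norm_eq_abs, sq_abs] at h3
  rw [sum_pad_sq hd, sum_pad_sq hd, ← h3, Real.sqrt_sq (norm_nonneg _),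
    Real.sqrt_sq (norm_nonneg _)]
  ring

theorem continuous_pad : Continuous (pad : 𝔼 → Fin 3 → ℝ) := by
  refine continuous_pi fun k => ?_
  by_cases h : (k : ℕ) < d
  · simp only [pad, h, dite_true]
    fun_prop
  · simp only [pad, h, dite_false]
    fun_prop

theorem continuous_cross_pad : Continuous fun p : 𝔼 × EuclideanSpace ℝ (Fin 3) × 𝔼 =>
    dotProduct (crossProduct (pad p.1) p.2.1.ofLp) (pad p.2.2) := by
  have h1 := fun k => (continuous_apply k).comp (continuous_pad (d := d))
  have h2 : ∀ k, Continuous fun p : 𝔼 × EuclideanSpace ℝ (Fin 3) × 𝔼 => pad p.1 k :=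
    fun k => (h1 k).comp continuous_fst
  have h3 : ∀ k, Continuous fun p : 𝔼 × EuclideanSpace ℝ (Fin 3) × 𝔼 => pad p.2.2 k :=
    fun k => (h1 k).comp (continuous_snd.comp continuous_snd)
  simp only [cross_apply, dotProduct, Fin.sum_univ_three]
  simp
  fun_prop

end Pointwise

/-! ### Seminorms, dual norms and inf-sup conditions -/

section Functionals

/-- The Euclidean combination of two seminorms. -/
def hypotSeminorm {E : Type*} [AddCommGroup E] [Module ℝ E] (p q : Seminorm ℝ E) :
    Seminorm ℝ E :=
  Seminorm.of (fun x => √(p x ^ 2 + q x ^ 2))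
    (fun x y => by
      have h1 : √(p (x + y) ^ 2 + q (x + y) ^ 2) ≤ √((p x + p y) ^ 2 + (q x + q y) ^ 2) := by
        gcongr
        · exact map_add_le_add p x y
        · exact map_add_le_add q x y
      have h2 := norm_add_le !₂[p x, q x] !₂[p y, q y]
      simp only [EuclideanSpace.norm_eq, Fin.sum_univ_two, Real.norm_eq_abs, sq_abs] at h2
      exact h1.trans h2)
    (fun c x => by
      rw [map_smul_eq_mul, map_smul_eq_mul, mul_pow, mul_pow, ← mul_add,
        Real.sqrt_mul (sq_nonneg _), Real.sqrt_sq (norm_nonneg _)])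

/-- A continuous functional is bounded by its dual norm with respect to an equivalent norm. -/
theorem le_sSup_mul_of_norm_le {V : Type*} [NormedAddCommGroup V] [NormedSpace ℝ V] (N : V → ℝ)
    (hN : ∀ v, 0 ≤ N v) (hneg : ∀ v, N (-v) = N v) {K : ℝ} (hK : ∀ v, ‖v‖ ≤ K * N v)
    (f : V →L[ℝ] ℝ) :
    0 ≤ sSup {t | ∃ v, v ≠ 0 ∧ t = f v / N v} ∧
      ∀ v, f v ≤ sSup {t | ∃ v, v ≠ 0 ∧ t = f v / N v} * N v := by
  have hS : 0 ≤ sSup {t | ∃ v, v ≠ 0 ∧ t = f v / N v} := by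
    by_cases h : ∃ v : V, v ≠ 0
    · obtain ⟨v, hv⟩ := h
      apply Real.sSup_nonneg'
      -- One of v and -v gives a nonnegative quotient.
      rcases le_total 0 (f v / N v) with h | h
      · exact ⟨_, ⟨v, hv, rfl⟩, h⟩
      · refine ⟨_, ⟨-v, neg_ne_zero.2 hv, rfl⟩, ?_⟩
        rw [hneg, map_neg, neg_div]
        linarith
    · have : {t | ∃ v, v ≠ 0 ∧ t = f v / N v} = ∅ :=
        Set.eq_empty_of_forall_notMem fun t ⟨v, hv, _⟩ => h ⟨v, hv⟩
      rw [this, Real.sSup_empty]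
  refine ⟨hS, fun v => ?_⟩
  by_cases hv : v = 0
  · rw [hv, map_zero]
    exact mul_nonneg hS (hN 0)
  · have hpos : 0 < N v := by
      refine lt_of_le_of_ne (hN v) fun h => hv ?_
      have := hK v
      rw [← h, mul_zero] at this
      exact norm_le_zero_iff.1 this
    rw [← div_le_iff₀ hpos]
    refine le_csSup ⟨‖f‖ * |K|, ?_⟩ ⟨v, hv, rfl⟩
    rintro t ⟨w, hw, rfl⟩
    refine div_le_of_le_mul₀ (hN w) (by positivity) ?_
    calc f w ≤ ‖f‖ * ‖w‖ := (le_abs_self _).trans (f.le_opNorm w)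
      _ ≤ ‖f‖ * (K * N w) := by gcongr; exact hK w
      _ ≤ ‖f‖ * |K| * N w := by
        rw [mul_assoc]
        gcongr
        · exact hN w
        · exact le_abs_self K

/-- An inf-sup condition provides a test function of prescribed size. -/
theorem exists_test_of_infSup {V : Type*} [AddCommGroup V] [Module ℝ V] (S : Submodule ℝ V)
    (N : Seminorm ℝ V) (hN : ∀ v, N v = 0 → v = 0) (f : V → ℝ) (hf : IsLinearMap ℝ f) {β A k : ℝ}
    (hβ : 0 < β) (hA : 0 ≤ A) (hk : k < 1)
    (h : A ≠ 0 → β ≤ sSup {t | ∃ w ∈ S, w ≠ 0 ∧ t = f w / (N w * A)}) :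
    ∃ w ∈ S, N w = β * A ∧ k * (β * A) ^ 2 ≤ f w := by
  rcases hA.eq_or_lt with hA0 | hA0
  · refine ⟨0, S.zero_mem, ?_, ?_⟩
    · rw [← hA0, map_zero, mul_zero]
    · have : f 0 = 0 := (hf.mk' f).map_zero
      rw [this, ← hA0]
      simp
  · have h1 := h hA0.ne'
    -- The supremum of the empty set is 0 by convention, which is below β.
    have hne : {t | ∃ w ∈ S, w ≠ 0 ∧ t = f w / (N w * A)}.Nonempty := by
      by_contra hemp
      rw [Set.not_nonempty_iff_eq_empty.1 hemp, Real.sSup_empty] at h1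
      linarith
    have h2 : k * β < β := by nlinarith
    obtain ⟨t, ⟨w, hw, hw0, rfl⟩, ht⟩ := exists_lt_of_lt_csSup hne (h2.trans_le h1)
    have hpos : 0 < N w := lt_of_le_of_ne (apply_nonneg N w) fun h => hw0 (hN w h.symm)
    -- A near-maximiser is rescaled to have norm β·A. The factor k < 1 is needed since the supremum
    -- is not known to be attained.
    refine ⟨(β * A / N w) • w, S.smul_mem _ hw, ?_, ?_⟩
    · rw [map_smul_eq_mul, Real.norm_of_nonneg (by positivity), div_mul_cancel₀ _ hpos.ne']
    · rw [hf.map_smul, smul_eq_mul]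
      rw [lt_div_iff₀ (by positivity)] at ht
      rw [div_mul_eq_mul_div, le_div_iff₀ hpos]
      have := mul_le_mul_of_nonneg_left ht.le (show 0 ≤ β * A by positivity)
      linarith

end Functionals

/-! ### Function spaces: linear maps, seminorms and measurability -/

section Maps

variable {d : ℕ} {Ω : Set (EuclideanSpace ℝ (Fin d))}

local notation "𝔼" => EuclideanSpace ℝ (Fin d)

/-- `fn` as a linear map. -/
def fnMap : H10 Ω →ₗ[ℝ] L2 Ω ℝ where
  toFun := fn
  map_add' _ _ := rfl
  map_smul' _ _ := rfl

/-- `grad` as a linear map. -/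
def gradMap : H10 Ω →ₗ[ℝ] L2 Ω 𝔼 where
  toFun := grad
  map_add' _ _ := rfl
  map_smul' _ _ := rfl

/-- `fld` as a linear map. -/
def fldMap : H0div Ω →ₗ[ℝ] L2 Ω 𝔼 where
  toFun := fld
  map_add' _ _ := rfl
  map_smul' _ _ := rfl

/-- `dv` as a linear map. -/
def dvMap : H0div Ω →ₗ[ℝ] L2 Ω ℝ where
  toFun := dv
  map_add' _ _ := rfl
  map_smul' _ _ := rfl

/-- All the gradients of a velocity field. -/
def velGradMap : Vel Ω →ₗ[ℝ] PiLp 2 fun _ : Fin d => L2 Ω 𝔼 where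
  toFun v := WithLp.toLp 2 fun i => grad (v i)
  map_add' _ _ := rfl
  map_smul' _ _ := rfl

/-- A field together with its divergence. -/
def fldDvMap : H0div Ω →ₗ[ℝ] WithLp 2 (L2 Ω 𝔼 × L2 Ω ℝ) where
  toFun K := WithLp.toLp 2 (fld K, dv K)
  map_add' _ _ := rfl
  map_smul' _ _ := rfl

/-- `‖∇·‖₀` on the velocity space as a seminorm. -/
def gradSeminorm : Seminorm ℝ (Vel Ω) := (normSeminorm ℝ _).comp velGradMap

/-- `divNorm` as a seminorm. -/
def divSeminorm : Seminorm ℝ (H0div Ω) := (normSeminorm ℝ _).comp fldDvMap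

theorem gradSeminorm_apply (v : Vel Ω) : gradSeminorm v = gradNorm v :=
  PiLp.norm_eq_of_L2 _

theorem divSeminorm_apply (K : H0div Ω) : divSeminorm K = divNorm K :=
  WithLp.prod_norm_eq_of_L2 _

theorem gradNorm_nonneg (v : Vel Ω) : 0 ≤ gradNorm v := Real.sqrt_nonneg _

theorem norm1_nonneg (η : Vel Ω × H0div Ω) : 0 ≤ norm1 η := Real.sqrt_nonneg _

theorem gradNorm_sq (v : Vel Ω) : gradNorm v ^ 2 = ∑ i, ‖grad (v i)‖ ^ 2 :=
  Real.sq_sqrt (by positivity)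

theorem divNorm_sq (K : H0div Ω) : divNorm K ^ 2 = ‖fld K‖ ^ 2 + ‖dv K‖ ^ 2 :=
  Real.sq_sqrt (by positivity)

theorem norm1_sq (η : Vel Ω × H0div Ω) :
    norm1 η ^ 2 = gradNorm η.1 ^ 2 + (‖fld η.2‖ ^ 2 + ‖dv η.2‖ ^ 2) := by
  rw [norm1, Real.sq_sqrt (by positivity), divNorm_sq]

theorem gradNorm_le_norm1 (η : Vel Ω × H0div Ω) : gradNorm η.1 ≤ norm1 η :=
  Real.le_sqrt_of_sq_le (by nlinarith [sq_nonneg (divNorm η.2)])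

theorem norm_grad_le_gradNorm (v : Vel Ω) (i : Fin d) : ‖grad (v i)‖ ≤ gradNorm v :=
  Real.le_sqrt_of_sq_le
    (Finset.single_le_sum (f := fun i => ‖grad (v i)‖ ^ 2) (fun _ _ => sq_nonneg _)
      (Finset.mem_univ i))

theorem gradInner_self (v : Vel Ω) : gradInner v v = gradNorm v ^ 2 := by
  rw [gradNorm_sq, gradInner]
  exact Finset.sum_congr rfl fun i _ => real_inner_self_eq_norm_sq _

theorem abs_gradInner_le (v w : Vel Ω) : |gradInner v w| ≤ gradNorm v * gradNorm w :=
  (Finset.abs_sum_le_sum_abs _ _).trans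
    ((Finset.sum_le_sum fun _ _ => abs_real_inner_le_norm _ _).trans
      (Real.sum_mul_le_sqrt_mul_sqrt _ _ _))

/-- The matrix of all the partial derivatives of a velocity field. -/
def gradMat (v : Vel Ω) (x : 𝔼) : PiLp 2 fun _ : Fin d => 𝔼 :=
  WithLp.toLp 2 fun i => grad (v i) x

theorem aeLinear_fn : AELinear (volume.restrict Ω) fun (r : H10 Ω) x => fn r x :=
  aeLinear_coe_Lp fnMap

theorem aeLinear_grad : AELinear (volume.restrict Ω) fun (r : H10 Ω) x => grad r x :=
  aeLinear_coe_Lp gradMap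

theorem aeLinear_fld : AELinear (volume.restrict Ω) fun (K : H0div Ω) x => fld K x :=
  aeLinear_coe_Lp fldMap

theorem aeLinear_val : AELinear (volume.restrict Ω) (Vel.val (Ω := Ω)) :=
  AELinear.toLp fun i => aeLinear_coe_Lp (fnMap ∘ₗ (LinearMap.proj i : Vel Ω →ₗ[ℝ] H10 Ω))

theorem aeLinear_gradMat : AELinear (volume.restrict Ω) (gradMat (Ω := Ω)) :=
  AELinear.toLp fun i => aeLinear_coe_Lp (gradMap ∘ₗ (LinearMap.proj i : Vel Ω →ₗ[ℝ] H10 Ω))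

theorem aestronglyMeasurable_toLp_pi {ι α F : Type*} [Fintype ι] [NormedAddCommGroup F]
    [SecondCountableTopology F] {m : MeasurableSpace α} {μ : Measure α} {f : ι → α → F}
    (hf : ∀ i, AEStronglyMeasurable (f i) μ) :
    AEStronglyMeasurable (fun x => WithLp.toLp 2 fun i => f i x) μ := by
  borelize F
  exact (PiLp.continuous_toLp 2 _).comp_aestronglyMeasurable
    (aemeasurable_pi_iff.2 fun i => (hf i).aemeasurable).aestronglyMeasurable

theorem aestronglyMeasurable_val (v : Vel Ω) :
    AEStronglyMeasurable v.val (volume.restrict Ω) :=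
  aestronglyMeasurable_toLp_pi fun i => (Lp.memLp (fn (v i))).1

theorem aestronglyMeasurable_gradMat (v : Vel Ω) :
    AEStronglyMeasurable (gradMat v) (volume.restrict Ω) :=
  aestronglyMeasurable_toLp_pi fun i => (Lp.memLp (grad (v i))).1

theorem eLpNorm_two_sq {F : Type*} [NormedAddCommGroup F] {α : Type*} {m : MeasurableSpace α}
    {μ : Measure α} (f : α → F) : eLpNorm f 2 μ ^ 2 = ∫⁻ x, ‖f x‖ₑ ^ 2 ∂μ := by
  rw [eLpNorm_eq_lintegral_rpow_enorm_toReal two_ne_zero ENNReal.ofNat_ne_top]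
  simp only [ENNReal.toReal_ofNat, ENNReal.rpow_ofNat, one_div]
  rw [← ENNReal.rpow_natCast, ← ENNReal.rpow_mul]
  norm_num

theorem eLpNorm_gradMat (v : Vel Ω) :
    eLpNorm (gradMat v) 2 (volume.restrict Ω) = ENNReal.ofReal (gradNorm v) := by
  refine (ENNReal.pow_right_strictMono two_ne_zero).injective ?_
  rw [eLpNorm_two_sq,
    ← ENNReal.ofReal_pow (gradNorm_nonneg v), gradNorm_sq,
    ENNReal.ofReal_sum_of_nonneg fun _ _ => sq_nonneg _]
  have h1 : ∀ x, ‖gradMat v x‖ₑ ^ 2 = ∑ i, ‖grad (v i) x‖ₑ ^ 2 := fun x => by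
    rw [← ofReal_norm, ← ENNReal.ofReal_pow (norm_nonneg _), PiLp.norm_sq_eq_of_L2,
      ENNReal.ofReal_sum_of_nonneg fun _ _ => sq_nonneg _]
    refine Finset.sum_congr rfl fun i _ => ?_
    rw [ENNReal.ofReal_pow (norm_nonneg _), ofReal_norm]
    rfl
  simp only [h1]
  rw [lintegral_finsetSum' _ fun i _ => ((Lp.memLp (grad (v i))).1.enorm.pow_const 2)]
  refine Finset.sum_congr rfl fun i _ => ?_
  rw [← eLpNorm_two_sq, ENNReal.ofReal_pow (norm_nonneg _), Lp.norm_def,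
    ENNReal.ofReal_toReal (Lp.eLpNorm_ne_top _)]

theorem memLp_gradMat (v : Vel Ω) : MemLp (gradMat v) 2 (volume.restrict Ω) :=
  ⟨aestronglyMeasurable_gradMat v, by rw [eLpNorm_gradMat]; exact ENNReal.ofReal_lt_top⟩

theorem toReal_eLpNorm_gradMat (v : Vel Ω) :
    (eLpNorm (gradMat v) 2 (volume.restrict Ω)).toReal = gradNorm v := by
  rw [eLpNorm_gradMat, ENNReal.toReal_ofReal (gradNorm_nonneg v)]

theorem aestronglyMeasurable_sum_inner_mul {α : Type*} {m : MeasurableSpace α} {μ : Measure α}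
    {a w : α → 𝔼} {A : α → PiLp 2 fun _ : Fin d => 𝔼} (ha : AEStronglyMeasurable a μ)
    (hA : AEStronglyMeasurable A μ) (hw : AEStronglyMeasurable w μ) :
    AEStronglyMeasurable (fun x => ∑ i, (∑ j, a x j * A x i j) * w x i) μ := by
  have h1 : ∀ j, Continuous fun y : 𝔼 => y j := fun j => PiLp.continuous_apply 2 _ j
  have h2 : ∀ i, Continuous fun y : PiLp 2 fun _ : Fin d => 𝔼 => y i := fun i =>
    PiLp.continuous_apply 2 _ i
  refine Finset.aestronglyMeasurable_fun_sum _ fun i _ => ?_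
  refine AEStronglyMeasurable.mul (Finset.aestronglyMeasurable_fun_sum _ fun j _ => ?_)
    ((h1 i).comp_aestronglyMeasurable hw)
  exact ((h1 j).comp_aestronglyMeasurable ha).mul ((h1 j).comp_aestronglyMeasurable
    ((h2 i).comp_aestronglyMeasurable hA))

/-- The L⁴ embedding is stated for squares, so each L⁴ factor contributes √λ₂; two of them give the
λ₂ of the transport estimates. -/
theorem toReal_le_sqrt_mul {a : ENNReal} {l t : ℝ} (hl : 0 ≤ l) (ht : 0 ≤ t)
    (h : a ^ 2 ≤ ENNReal.ofReal (l * t ^ 2)) : a ≠ ⊤ ∧ a.toReal ≤ √l * t := by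
  constructor
  · rintro rfl
    simp at h
  · have h1 := ENNReal.toReal_mono ENNReal.ofReal_ne_top h
    rw [ENNReal.toReal_pow, ENNReal.toReal_ofReal (by positivity)] at h1
    have h2 := Real.le_sqrt_of_sq_le h1
    rwa [Real.sqrt_mul hl, Real.sqrt_sq ht] at h2

end Maps

/-! ### Consequences of the embeddings: definiteness and bounds of the integrals -/

namespace EmbeddingConstants

variable {d : ℕ} {Ω : Set (EuclideanSpace ℝ (Fin d))} {l1 l2 C : ℝ}
  (hemb : EmbeddingConstants Ω l1 l2 C)

include hemb

theorem memLp_val_four (v : Vel Ω) : MemLp v.val 4 (volume.restrict Ω) :=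
  ⟨aestronglyMeasurable_val v,
    (toReal_le_sqrt_mul hemb.l2_pos.le (gradNorm_nonneg v) (hemb.vel_L4 v)).1.lt_top⟩

theorem eLpNorm_val_four_le (v : Vel Ω) :
    (eLpNorm v.val 4 (volume.restrict Ω)).toReal ≤ √l2 * gradNorm v :=
  (toReal_le_sqrt_mul hemb.l2_pos.le (gradNorm_nonneg v) (hemb.vel_L4 v)).2

theorem memLp_fn_four (r : H10 Ω) : MemLp (fn r) 4 (volume.restrict Ω) :=
  ⟨(Lp.memLp (fn r)).1,
    (toReal_le_sqrt_mul hemb.l2_pos.le (norm_nonneg (grad r)) (hemb.scal_L4 r)).1.lt_top⟩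

theorem eLpNorm_fn_four_le (r : H10 Ω) :
    (eLpNorm (fn r) 4 (volume.restrict Ω)).toReal ≤ √l2 * ‖grad r‖ :=
  (toReal_le_sqrt_mul hemb.l2_pos.le (norm_nonneg (grad r)) (hemb.scal_L4 r)).2

theorem memLp_val_six (v : Vel Ω) : MemLp v.val 6 (volume.restrict Ω) :=
  ⟨aestronglyMeasurable_val v, (hemb.vel_L6 v).trans_lt ENNReal.ofReal_lt_top⟩

theorem eLpNorm_val_six_le (v : Vel Ω) :
    (eLpNorm v.val 6 (volume.restrict Ω)).toReal ≤ l1 * gradNorm v :=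
  ENNReal.toReal_le_of_le_ofReal (mul_nonneg hemb.l1_pos.le (gradNorm_nonneg v)) (hemb.vel_L6 v)

theorem memLp_val_two (v : Vel Ω) : MemLp v.val 2 (volume.restrict Ω) :=
  ⟨aestronglyMeasurable_val v, (hemb.vel_L2 v).trans_lt ENNReal.ofReal_lt_top⟩

theorem eLpNorm_val_two_le (v : Vel Ω) :
    (eLpNorm v.val 2 (volume.restrict Ω)).toReal ≤ C * gradNorm v :=
  ENNReal.toReal_le_of_le_ofReal (mul_nonneg hemb.C_pos.le (gradNorm_nonneg v)) (hemb.vel_L2 v)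

theorem norm_fn_le (r : H10 Ω) : ‖fn r‖ ≤ C * ‖grad r‖ := by
  rw [Lp.norm_def]
  exact ENNReal.toReal_le_of_le_ofReal (mul_nonneg hemb.C_pos.le (norm_nonneg _))
    (hemb.scal_L2 r)

/-- The norm of `H10` is inherited from a product, hence is the maximum of the norms of function and
gradient. -/
theorem norm_le_norm_grad (r : H10 Ω) : ‖r‖ ≤ max C 1 * ‖grad r‖ := by
  refine max_le ?_ ?_
  · exact (hemb.norm_fn_le r).trans
      (mul_le_mul_of_nonneg_right (le_max_left _ _) (norm_nonneg _))
  · exact le_mul_of_one_le_left (norm_nonneg (grad r)) (le_max_right _ _)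

theorem norm_le_gradNorm (v : Vel Ω) : ‖v‖ ≤ max C 1 * gradNorm v :=
  (pi_norm_le_iff_of_nonneg
    (mul_nonneg (zero_le_one.trans (le_max_right _ _)) (gradNorm_nonneg v))).2 fun i =>
    (hemb.norm_le_norm_grad (v i)).trans
      (mul_le_mul_of_nonneg_left (norm_grad_le_gradNorm v i)
        (zero_le_one.trans (le_max_right _ _)))

theorem eq_zero_of_norm_grad (r : H10 Ω) (h : ‖grad r‖ = 0) : r = 0 := by
  have := hemb.norm_le_norm_grad r
  rw [h, mul_zero] at this
  exact norm_le_zero_iff.1 this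

theorem eq_zero_of_gradNorm (v : Vel Ω) (h : gradNorm v = 0) : v = 0 := by
  have := hemb.norm_le_gradNorm v
  rw [h, mul_zero] at this
  exact norm_le_zero_iff.1 this

theorem conv_integrable_and_le (u v w : Vel Ω) :
    Integrable (fun x => ∑ i, (∑ j, fn (u j) x * grad (v i) x j) * fn (w i) x)
      (volume.restrict Ω) ∧ |conv u v w| ≤ l2 * gradNorm u * gradNorm v * gradNorm w := by
  have hk : AEStronglyMeasurable
      (fun x => ∑ i, (∑ j, u.val x j * gradMat v x i j) * w.val x i) (volume.restrict Ω) :=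
    aestronglyMeasurable_sum_inner_mul (aestronglyMeasurable_val u)
      (aestronglyMeasurable_gradMat v) (aestronglyMeasurable_val w)
  obtain ⟨h1, h2⟩ := integrable_and_abs_integral_le₃ (hemb.memLp_val_four u) (memLp_gradMat v)
    (hemb.memLp_val_four w) hk fun x => abs_sum_inner_mul_le (u.val x) (w.val x) (gradMat v x)
  refine ⟨h1, h2.trans ?_⟩
  rw [toReal_eLpNorm_gradMat]
  have hv := gradNorm_nonneg v
  have hu := gradNorm_nonneg u
  calc _ ≤ (√l2 * gradNorm u) * gradNorm v * (√l2 * gradNorm w) := by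
        gcongr
        · exact hemb.eLpNorm_val_four_le u
        · exact hemb.eLpNorm_val_four_le w
    _ = (√l2 * √l2) * gradNorm u * gradNorm v * gradNorm w := by ring
    _ = _ := by rw [Real.mul_self_sqrt hemb.l2_pos.le]

theorem convT_integrable_and_le (u : Vel Ω) (θ r : H10 Ω) :
    Integrable (fun x => (∑ j, fn (u j) x * grad θ x j) * fn r x)
      (volume.restrict Ω) ∧ |convT u θ r| ≤ l2 * gradNorm u * ‖grad θ‖ * ‖grad r‖ := by
  have hk : AEStronglyMeasurable (fun x => (∑ j, fn (u j) x * grad θ x j) * fn r x)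
      (volume.restrict Ω) := by
    have hc : Continuous fun p : EuclideanSpace ℝ (Fin d) × EuclideanSpace ℝ (Fin d) × ℝ =>
        (∑ j, p.1 j * p.2.1 j) * p.2.2 := by fun_prop
    exact hc.comp_aestronglyMeasurable ((aestronglyMeasurable_val u).prodMk
      ((Lp.memLp (grad θ)).1.prodMk (Lp.memLp (fn r)).1))
  obtain ⟨h1, h2⟩ := integrable_and_abs_integral_le₃ (hemb.memLp_val_four u)
    (Lp.memLp (grad θ)) (hemb.memLp_fn_four r) hk
    fun x => abs_sum_mul_le (u.val x) (grad θ x) (fn r x)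
  refine ⟨h1, h2.trans ?_⟩
  rw [← Lp.norm_def]
  have hu := gradNorm_nonneg u
  calc _ ≤ (√l2 * gradNorm u) * ‖grad θ‖ * (√l2 * ‖grad r‖) := by
        gcongr
        · exact hemb.eLpNorm_val_four_le u
        · exact hemb.eLpNorm_fn_four_le r
    _ = (√l2 * √l2) * gradNorm u * ‖grad θ‖ * ‖grad r‖ := by ring
    _ = _ := by rw [Real.mul_self_sqrt hemb.l2_pos.le]

theorem cross_integrable_and_le (hd : d = 2 ∨ d = 3)
    {B : EuclideanSpace ℝ (Fin d) → EuclideanSpace ℝ (Fin 3)}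
    (hB : MemLp B 3 (volume.restrict Ω)) (K : H0div Ω) (v : Vel Ω) :
    Integrable (fun x => dotProduct (crossProduct (pad (fld K x)) (B x).ofLp) (pad (v.val x)))
      (volume.restrict Ω) ∧
    |∫ x in Ω, dotProduct (crossProduct (pad (fld K x)) (B x).ofLp) (pad (v.val x))| ≤
      (eLpNorm B 3 (volume.restrict Ω)).toReal * ‖fld K‖ * (l1 * gradNorm v) := by
  have hk := continuous_cross_pad.comp_aestronglyMeasurable
    ((Lp.memLp (fld K)).1.prodMk (hB.1.prodMk (aestronglyMeasurable_val v)))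
  obtain ⟨h1, h2⟩ := integrable_and_abs_integral_le₃ hB (Lp.memLp (fld K))
    (hemb.memLp_val_six v) hk fun x => abs_cross_pad_le hd (fld K x) (v.val x) (B x)
  refine ⟨h1, h2.trans ?_⟩
  rw [← Lp.norm_def]
  gcongr
  exact hemb.eLpNorm_val_six_le v

theorem buoyancy_integrable_and_le {e : EuclideanSpace ℝ (Fin d)} (he : ‖e‖ = 1) (θ : H10 Ω)
    (v : Vel Ω) : Integrable (fun x => fn θ x * inner ℝ e (v.val x)) (volume.restrict Ω) ∧
    |∫ x in Ω, fn θ x * inner ℝ e (v.val x)| ≤ C ^ 2 * ‖grad θ‖ * gradNorm v := by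
  have hk : AEStronglyMeasurable (fun x => fn θ x * inner ℝ e (v.val x))
      (volume.restrict Ω) :=
    (Lp.memLp (fn θ)).1.mul (aestronglyMeasurable_const.inner (aestronglyMeasurable_val v))
  obtain ⟨h1, h2⟩ := integrable_and_abs_integral_le (Lp.memLp (fn θ)) (hemb.memLp_val_two v) hk
    fun x => by
      rw [abs_mul, Real.norm_eq_abs]
      gcongr
      simpa [he] using abs_real_inner_le_norm e (v.val x)
  refine ⟨h1, h2.trans ?_⟩
  rw [← Lp.norm_def]
  have hC := hemb.C_pos
  calc _ ≤ (C * ‖grad θ‖) * (C * gradNorm v) := by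
        gcongr
        · exact hemb.norm_fn_le θ
        · exact hemb.eLpNorm_val_two_le v
    _ = _ := by ring

end EmbeddingConstants

/-! ### Linearity of the integral forms in each argument -/

section Linear

variable {d : ℕ} {Ω : Set (EuclideanSpace ℝ (Fin d))} {l1 l2 C : ℝ}

theorem integrable_mul_divergence (q : L2 Ω ℝ) (v : Vel Ω) :
    Integrable (fun x => q x * ∑ i, grad (v i) x i) (volume.restrict Ω) := by
  simp only [Finset.mul_sum]
  refine integrable_finsetSum _ fun i _ => ?_
  have hc : Continuous fun y : EuclideanSpace ℝ (Fin d) => y i := by fun_prop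
  refine (integrable_and_abs_integral_le (Lp.memLp q) (Lp.memLp (grad (v i)))
    ((Lp.memLp q).1.mul (hc.comp_aestronglyMeasurable (Lp.memLp (grad (v i))).1)) fun x => ?_).1
  rw [Pi.mul_apply, abs_mul]
  exact mul_le_mul_of_nonneg_left (PiLp.norm_apply_le (grad (v i) x) i) (abs_nonneg _)

theorem isLinearMap_conv₁ (hemb : EmbeddingConstants Ω l1 l2 C) (v w : Vel Ω) :
    IsLinearMap ℝ fun u => conv u v w :=
  (aeLinear_val.comp (fun x a => ∑ i, (∑ j, a j * grad (v i) x j) * fn (w i) x) fun x =>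
    { map_add := fun a b => by simp [add_mul, Finset.sum_add_distrib]
      map_smul := fun c a => by simp [mul_assoc, Finset.mul_sum, Finset.sum_mul]
      }).isLinearMap_integral fun u => (hemb.conv_integrable_and_le u v w).1

theorem isLinearMap_conv₂ (hemb : EmbeddingConstants Ω l1 l2 C) (u w : Vel Ω) :
    IsLinearMap ℝ fun v => conv u v w :=
  (aeLinear_gradMat.comp (fun x A => ∑ i, (∑ j, fn (u j) x * A i j) * fn (w i) x) fun x =>
    { map_add := fun a b => by simp [add_mul, mul_add, Finset.sum_add_distrib]
      map_smul := fun c a => by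
        simp [mul_assoc, mul_left_comm _ c, Finset.mul_sum, Finset.sum_mul]
      }).isLinearMap_integral fun v => (hemb.conv_integrable_and_le u v w).1

theorem isLinearMap_conv₃ (hemb : EmbeddingConstants Ω l1 l2 C) (u v : Vel Ω) :
    IsLinearMap ℝ fun w => conv u v w :=
  (aeLinear_val.comp (fun x a => ∑ i, (∑ j, fn (u j) x * grad (v i) x j) * a i) fun x =>
    { map_add := fun a b => by simp [mul_add, Finset.sum_add_distrib]
      map_smul := fun c a => by simp [mul_left_comm _ c, Finset.mul_sum]
      }).isLinearMap_integral fun w => (hemb.conv_integrable_and_le u v w).1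

theorem isLinearMap_convT₁ (hemb : EmbeddingConstants Ω l1 l2 C) (θ r : H10 Ω) :
    IsLinearMap ℝ fun u => convT u θ r :=
  (aeLinear_val.comp (fun x a => (∑ j, a j * grad θ x j) * fn r x) fun x =>
    { map_add := fun a b => by simp [add_mul, Finset.sum_add_distrib]
      map_smul := fun c a => by simp [mul_assoc, Finset.mul_sum, Finset.sum_mul]
      }).isLinearMap_integral fun u => (hemb.convT_integrable_and_le u θ r).1

theorem isLinearMap_convT₂ (hemb : EmbeddingConstants Ω l1 l2 C) (u : Vel Ω) (r : H10 Ω) :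
    IsLinearMap ℝ fun θ => convT u θ r :=
  (aeLinear_grad.comp (fun x a => (∑ j, fn (u j) x * a j) * fn r x) fun x =>
    { map_add := fun a b => by simp [add_mul, mul_add, Finset.sum_add_distrib]
      map_smul := fun c a => by
        simp [mul_assoc, mul_left_comm _ c, Finset.mul_sum, Finset.sum_mul]
      }).isLinearMap_integral fun θ => (hemb.convT_integrable_and_le u θ r).1

theorem isLinearMap_convT₃ (hemb : EmbeddingConstants Ω l1 l2 C) (u : Vel Ω) (θ : H10 Ω) :
    IsLinearMap ℝ fun r => convT u θ r :=
  (aeLinear_fn.comp (fun x a => (∑ j, fn (u j) x * grad θ x j) * a) fun x =>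
    { map_add := fun a b => by simp [mul_add]
      map_smul := fun c a => by simp [mul_left_comm _ c]
      }).isLinearMap_integral fun r => (hemb.convT_integrable_and_le u θ r).1

theorem isLinearMap_bs₁ (P : Data Ω) (v : Vel Ω) : IsLinearMap ℝ fun q => P.bs q v :=
  (((aeLinear_coe_Lp (LinearMap.id : L2 Ω ℝ →ₗ[ℝ] L2 Ω ℝ)).comp
    (fun x a => a * ∑ i, grad (v i) x i) fun x =>
    { map_add := fun a b => by simp [add_mul]
      map_smul := fun c a => by simp [mul_assoc]
      }).isLinearMap_integral fun q => integrable_mul_divergence q v).const_mul _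

theorem isLinearMap_bs₂ (P : Data Ω) (q : L2 Ω ℝ) : IsLinearMap ℝ fun v => P.bs q v :=
  ((aeLinear_gradMat.comp (fun x A => q x * ∑ i, A i i) fun x =>
    { map_add := fun a b => by simp [mul_add, Finset.sum_add_distrib]
      map_smul := fun c a => by simp [mul_left_comm _ c, Finset.mul_sum]
      }).isLinearMap_integral fun v => integrable_mul_divergence q v).const_mul _

theorem isLinearMap_bm₁ (P : Data Ω) (K : H0div Ω) : IsLinearMap ℝ fun ψ => P.bm ψ K :=
  (isLinearMap_inner_left (dv K)).const_mul _

theorem isLinearMap_bm₂ (P : Data Ω) (ψ : L2 Ω ℝ) : IsLinearMap ℝ fun K => P.bm ψ K :=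
  ((isLinearMap_inner_right ψ).comp_linearMap dvMap).const_mul _

theorem isLinearMap_dForm₁ (hemb : EmbeddingConstants Ω l1 l2 C) (hd : d = 2 ∨ d = 3)
    (P : Data Ω) (hB : MemLp P.B 3 (volume.restrict Ω)) (v : Vel Ω) :
    IsLinearMap ℝ fun K => P.dForm K v :=
  ((aeLinear_fld.comp (fun x a => dotProduct (crossProduct (pad a) (P.B x).ofLp) (pad (v.val x)))
    fun x =>
    { map_add := fun a b => by simp [pad_add, add_dotProduct]
      map_smul := fun c a => by simp [pad_smul, smul_dotProduct]
      }).isLinearMap_integral fun K => (hemb.cross_integrable_and_le hd hB K v).1).const_mul _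

theorem isLinearMap_dForm₂ (hemb : EmbeddingConstants Ω l1 l2 C) (hd : d = 2 ∨ d = 3)
    (P : Data Ω) (hB : MemLp P.B 3 (volume.restrict Ω)) (K : H0div Ω) :
    IsLinearMap ℝ fun v => P.dForm K v :=
  ((aeLinear_val.comp (fun x a => dotProduct (crossProduct (pad (fld K x)) (P.B x).ofLp) (pad a))
    fun x =>
    { map_add := fun a b => by simp [pad_add, dotProduct_add]
      map_smul := fun c a => by simp [pad_smul, dotProduct_smul]
      }).isLinearMap_integral fun v => (hemb.cross_integrable_and_le hd hB K v).1).const_mul _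

theorem isLinearMap_Q₁ (hemb : EmbeddingConstants Ω l1 l2 C) (P : Data Ω) (hdir : ‖P.dir‖ = 1)
    (Φ : Vel Ω × H0div Ω) : IsLinearMap ℝ fun θ => P.Q θ Φ :=
  ((aeLinear_fn.comp (fun x a => a * inner ℝ P.dir (Φ.1.val x)) fun x =>
    { map_add := fun a b => by simp [add_mul]
      map_smul := fun c a => by simp [mul_assoc]
      }).isLinearMap_integral
        fun θ => (hemb.buoyancy_integrable_and_le hdir θ Φ.1).1).const_mul _

theorem isLinearMap_Q₂ (hemb : EmbeddingConstants Ω l1 l2 C) (P : Data Ω) (hdir : ‖P.dir‖ = 1)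
    (θ : H10 Ω) : IsLinearMap ℝ fun Φ => P.Q θ Φ :=
  ((aeLinear_val.comp (fun x a => fn θ x * inner ℝ P.dir a) fun x =>
    { map_add := fun a b => by simp [inner_add_right, mul_add]
      map_smul := fun c a => by simp [real_inner_smul_right, mul_left_comm _ c]
      }).isLinearMap_integral
        fun v => (hemb.buoyancy_integrable_and_le hdir θ v).1).comp_fst.const_mul _

theorem isLinearMap_gradInner_left (w : Vel Ω) : IsLinearMap ℝ fun v => gradInner v w :=
  (isLinearMap_inner_left (velGradMap w)).comp_linearMap velGradMap

theorem isLinearMap_gradInner_right (v : Vel Ω) : IsLinearMap ℝ fun w => gradInner v w :=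
  (isLinearMap_inner_right (velGradMap v)).comp_linearMap velGradMap

end Linear

/-! ### Continuity and coercivity of the forms -/

section Forms

variable {d : ℕ} {Ω : Set (EuclideanSpace ℝ (Fin d))} {l1 l2 C : ℝ}

theorem A1_self (ζ η : Vel Ω × H0div Ω) : A1 ζ η η = 0 := sub_self _

theorem H_self (ζ : Vel Ω × H0div Ω) (θ : H10 Ω) : H ζ θ θ = 0 := sub_self _

theorem abs_half_sub_half_le {x y b : ℝ} (hx : |x| ≤ b) (hy : |y| ≤ b) :
    |1 / 2 * x - 1 / 2 * y| ≤ b := by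
  rw [abs_le] at *
  constructor <;> linarith

theorem EmbeddingConstants.abs_A1_le (hemb : EmbeddingConstants Ω l1 l2 C)
    (ζ η Φ : Vel Ω × H0div Ω) : |A1 ζ η Φ| ≤ l2 * norm1 ζ * norm1 η * norm1 Φ := by
  have h1 := (hemb.conv_integrable_and_le ζ.1 η.1 Φ.1).2
  have h2 := (hemb.conv_integrable_and_le ζ.1 Φ.1 η.1).2
  have h3 : |A1 ζ η Φ| ≤ l2 * gradNorm ζ.1 * gradNorm η.1 * gradNorm Φ.1 :=
    abs_half_sub_half_le h1 (h2.trans_eq (by ring))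
  have hl := hemb.l2_pos.le
  have hn := fun η : Vel Ω × H0div Ω => gradNorm_nonneg η.1
  have hn1 := norm1_nonneg (Ω := Ω)
  refine h3.trans ?_
  gcongr
  · exact hn Φ
  · exact mul_nonneg (mul_nonneg hl (hn1 ζ)) (hn1 η)
  · exact hn η
  · exact mul_nonneg hl (hn1 ζ)
  · exact gradNorm_le_norm1 ζ
  · exact gradNorm_le_norm1 η
  · exact gradNorm_le_norm1 Φ

theorem EmbeddingConstants.abs_H_le (hemb : EmbeddingConstants Ω l1 l2 C)
    (ζ : Vel Ω × H0div Ω) (θ r : H10 Ω) : |H ζ θ r| ≤ l2 * norm1 ζ * ‖grad θ‖ * ‖grad r‖ := by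
  have h1 := (hemb.convT_integrable_and_le ζ.1 θ r).2
  have h2 := (hemb.convT_integrable_and_le ζ.1 r θ).2
  have h3 : |H ζ θ r| ≤ l2 * gradNorm ζ.1 * ‖grad θ‖ * ‖grad r‖ :=
    abs_half_sub_half_le h1 (h2.trans_eq (by ring))
  have hl := hemb.l2_pos.le
  refine h3.trans ?_
  gcongr
  exact gradNorm_le_norm1 ζ

theorem EmbeddingConstants.abs_Q_le (hemb : EmbeddingConstants Ω l1 l2 C) {P : Data Ω}
    (hPr : 0 < P.Pr) (hRa : 0 ≤ P.Ra) (hdir : ‖P.dir‖ = 1) (θ : H10 Ω) (Φ : Vel Ω × H0div Ω) :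
    |P.Q θ Φ| ≤ P.lamq C * ‖grad θ‖ * norm1 Φ := by
  have h1 := (hemb.buoyancy_integrable_and_le hdir θ Φ.1).2
  rw [Data.Q, abs_mul, abs_mul, abs_neg, abs_of_pos hPr, abs_of_nonneg hRa, Data.lamq]
  calc _ ≤ P.Pr * P.Ra * (C ^ 2 * ‖grad θ‖ * norm1 Φ) := by
        gcongr
        refine h1.trans ?_
        gcongr
        exact gradNorm_le_norm1 Φ
    _ = _ := by ring

theorem EmbeddingConstants.abs_dForm_le (hemb : EmbeddingConstants Ω l1 l2 C)
    (hd : d = 2 ∨ d = 3) {P : Data Ω} (hκ : 0 < P.κ) (hB : MemLp P.B 3 (volume.restrict Ω))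
    (K : H0div Ω) (v : Vel Ω) :
    |P.dForm K v| ≤
      P.κ * l1 * (eLpNorm P.B 3 (volume.restrict Ω)).toReal * (‖fld K‖ * gradNorm v) := by
  have h1 := (hemb.cross_integrable_and_le hd hB K v).2
  rw [Data.dForm, abs_mul, abs_neg, abs_of_pos hκ]
  exact (mul_le_mul_of_nonneg_left h1 hκ.le).trans_eq (by ring)

theorem EmbeddingConstants.abs_A0_le (hemb : EmbeddingConstants Ω l1 l2 C)
    (hd : d = 2 ∨ d = 3) {P : Data Ω} (hPr : 0 < P.Pr) (hκ : 0 < P.κ)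
    (hB : MemLp P.B 3 (volume.restrict Ω)) (η Φ : Vel Ω × H0div Ω) :
    |P.A0 η Φ| ≤ P.Cmax l1 * norm1 η * norm1 Φ := by
  set b := P.κ * l1 * (eLpNorm P.B 3 (volume.restrict Ω)).toReal with hb
  set m := max (max P.Pr P.κ) b with hm
  have hm1 : P.Pr ≤ m := (le_max_left _ _).trans (le_max_left _ _)
  have hm2 : P.κ ≤ m := (le_max_right _ _).trans (le_max_left _ _)
  have hm3 : b ≤ m := le_max_right _ _
  have hC : P.Cmax l1 = 2 * m := rfl
  have hm0 : 0 ≤ m := hPr.le.trans hm1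
  have hu := gradNorm_nonneg η.1
  have hv := gradNorm_nonneg Φ.1
  have h1 : |P.Pr * gradInner η.1 Φ.1| ≤ m * (gradNorm η.1 * gradNorm Φ.1) := by
    rw [abs_mul, abs_of_pos hPr]
    gcongr
    exact abs_gradInner_le _ _
  have h2 : |P.κ * inner ℝ (fld η.2) (fld Φ.2)| ≤ m * (‖fld η.2‖ * ‖fld Φ.2‖) := by
    rw [abs_mul, abs_of_pos hκ]
    gcongr
    exact abs_real_inner_le_norm _ _
  have h3 : |P.dForm η.2 Φ.1| ≤ m * (‖fld η.2‖ * gradNorm Φ.1) :=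
    (hemb.abs_dForm_le hd hκ hB _ _).trans (by gcongr)
  have h4 : |P.dForm Φ.2 η.1| ≤ m * (‖fld Φ.2‖ * gradNorm η.1) :=
    (hemb.abs_dForm_le hd hκ hB _ _).trans (by gcongr)
  have h5 : |P.A0 η Φ| ≤ m * ((gradNorm η.1 + ‖fld η.2‖) * (gradNorm Φ.1 + ‖fld Φ.2‖)) := by
    rw [Data.A0]
    rw [abs_le] at *
    constructor <;> linarith
  -- The bound a + b ≤ √2·√(a² + b²), used for both arguments, produces the factor 2 in `Cmax`.
  have h6 : ∀ ζ : Vel Ω × H0div Ω, gradNorm ζ.1 + ‖fld ζ.2‖ ≤ √2 * norm1 ζ := fun ζ => by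
    rw [← Real.sqrt_sq (norm1_nonneg ζ), ← Real.sqrt_mul zero_le_two]
    apply Real.le_sqrt_of_sq_le
    rw [norm1_sq]
    nlinarith [sq_nonneg (gradNorm ζ.1 - ‖fld ζ.2‖), sq_nonneg ‖dv ζ.2‖]
  refine h5.trans ?_
  have h7 : (gradNorm η.1 + ‖fld η.2‖) * (gradNorm Φ.1 + ‖fld Φ.2‖) ≤
      (√2 * norm1 η) * (√2 * norm1 Φ) :=
    mul_le_mul (h6 η) (h6 Φ) (by positivity) (mul_nonneg (Real.sqrt_nonneg _) (norm1_nonneg _))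
  have h8 := mul_le_mul_of_nonneg_left h7 hm0
  have h9 : (√2 * norm1 η) * (√2 * norm1 Φ) = 2 * (norm1 η * norm1 Φ) := by
    rw [mul_mul_mul_comm, Real.mul_self_sqrt zero_le_two]
  rw [h9] at h8
  rw [hC]
  linarith

/-- The two magnetic terms cancel on the diagonal, and zero divergence reduces the norm of the
current to its L² part. -/
theorem coercive_A0 {P : Data Ω} (η : Vel Ω × H0div Ω) (hη : dv η.2 = 0) :
    P.Cmin * norm1 η ^ 2 ≤ P.A0 η η := by
  rw [norm1_sq, hη, Data.A0, gradInner_self, real_inner_self_eq_norm_sq, norm_zero]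
  have h1 : P.Cmin * gradNorm η.1 ^ 2 ≤ P.Pr * gradNorm η.1 ^ 2 :=
    mul_le_mul_of_nonneg_right (min_le_left _ _) (sq_nonneg _)
  have h2 : P.Cmin * ‖fld η.2‖ ^ 2 ≤ P.κ * ‖fld η.2‖ ^ 2 :=
    mul_le_mul_of_nonneg_right (min_le_right _ _) (sq_nonneg _)
  linarith

theorem gradNorm_neg (v : Vel Ω) : gradNorm (-v) = gradNorm v := by
  rw [← gradSeminorm_apply, ← gradSeminorm_apply, map_neg_eq_map]

theorem EmbeddingConstants.dualNormVel_spec (hemb : EmbeddingConstants Ω l1 l2 C)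
    (f : Vel Ω →L[ℝ] ℝ) : 0 ≤ dualNormVel f ∧ ∀ v, f v ≤ dualNormVel f * gradNorm v :=
  le_sSup_mul_of_norm_le gradNorm gradNorm_nonneg gradNorm_neg hemb.norm_le_gradNorm f

theorem EmbeddingConstants.dualNorm_spec (hemb : EmbeddingConstants Ω l1 l2 C)
    (f : H10 Ω →L[ℝ] ℝ) : 0 ≤ dualNorm f ∧ ∀ r, f r ≤ dualNorm f * ‖grad r‖ :=
  le_sSup_mul_of_norm_le (fun r => ‖grad r‖) (fun _ => norm_nonneg _)
    (fun r => norm_neg (grad r)) hemb.norm_le_norm_grad f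

theorem EmbeddingConstants.L_le (hemb : EmbeddingConstants Ω l1 l2 C) {P : Data Ω}
    (hκ : 0 < P.κ) (Φ : Vel Ω × H0div Ω) : P.L Φ ≤ P.normL * norm1 Φ := by
  obtain ⟨h0, h1⟩ := hemb.dualNormVel_spec P.f
  have h2 : P.κ * inner ℝ P.g (fld Φ.2) ≤ P.κ * (‖P.g‖ * ‖fld Φ.2‖) :=
    mul_le_mul_of_nonneg_left (real_inner_le_norm _ _) hκ.le
  have hv := gradNorm_nonneg Φ.1
  calc P.L Φ ≤ dualNormVel P.f * gradNorm Φ.1 + (P.κ * ‖P.g‖) * ‖fld Φ.2‖ := by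
        rw [Data.L]
        linarith [h1 Φ.1]
    _ ≤ √((dualNormVel P.f ^ 2 + P.κ ^ 2 * ‖P.g‖ ^ 2) * norm1 Φ ^ 2) := by
        apply Real.le_sqrt_of_sq_le
        rw [norm1_sq]
        have h3 : (dualNormVel P.f * gradNorm Φ.1 + (P.κ * ‖P.g‖) * ‖fld Φ.2‖) ^ 2 ≤
            (dualNormVel P.f ^ 2 + P.κ ^ 2 * ‖P.g‖ ^ 2) *
              (gradNorm Φ.1 ^ 2 + ‖fld Φ.2‖ ^ 2) := by
          nlinarith [sq_nonneg (dualNormVel P.f * ‖fld Φ.2‖ - P.κ * ‖P.g‖ * gradNorm Φ.1)]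
        refine h3.trans (mul_le_mul_of_nonneg_left ?_ (by positivity))
        nlinarith [sq_nonneg ‖dv Φ.2‖]
    _ = _ := by
        rw [Real.sqrt_mul (by positivity), Real.sqrt_sq (norm1_nonneg _), Data.normL]

theorem EmbeddingConstants.eq_zero_of_norm1 (hemb : EmbeddingConstants Ω l1 l2 C)
    (η : Vel Ω × H0div Ω) (h : norm1 η = 0) : η = 0 := by
  have h1 := norm1_sq η
  rw [h, zero_pow two_ne_zero] at h1
  obtain ⟨h2, h3⟩ := (add_eq_zero_iff_of_nonneg (sq_nonneg _) (by positivity)).1 h1.symm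
  obtain ⟨h4, h5⟩ := (add_eq_zero_iff_of_nonneg (sq_nonneg _) (sq_nonneg _)).1 h3
  have h6 : η.2.1 = 0 := Prod.ext (norm_eq_zero.1 (pow_eq_zero_iff two_ne_zero |>.1 h4))
    (norm_eq_zero.1 (pow_eq_zero_iff two_ne_zero |>.1 h5))
  exact Prod.ext (hemb.eq_zero_of_gradNorm _ (pow_eq_zero_iff two_ne_zero |>.1 h2))
    (Subtype.ext h6)

theorem isLinearMap_A0_left (hemb : EmbeddingConstants Ω l1 l2 C) (hd : d = 2 ∨ d = 3)
    (P : Data Ω) (hB : MemLp P.B 3 (volume.restrict Ω)) (Φ : Vel Ω × H0div Ω) :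
    IsLinearMap ℝ fun η => P.A0 η Φ := by
  have h1 := ((isLinearMap_gradInner_left Φ.1).comp_fst (V := H0div Ω)).const_mul P.Pr
  have h2 := (((isLinearMap_inner_left (fld Φ.2)).comp_linearMap fldMap).comp_snd
    (U := Vel Ω)).const_mul P.κ
  have h3 := (isLinearMap_dForm₁ hemb hd P hB Φ.1).comp_snd (U := Vel Ω)
  have h4 := (isLinearMap_dForm₂ hemb hd P hB Φ.2).comp_fst (V := H0div Ω)
  exact ((h1.add' h2).add' h3).sub' h4

theorem isLinearMap_A0_right (hemb : EmbeddingConstants Ω l1 l2 C) (hd : d = 2 ∨ d = 3)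
    (P : Data Ω) (hB : MemLp P.B 3 (volume.restrict Ω)) (η : Vel Ω × H0div Ω) :
    IsLinearMap ℝ fun Φ => P.A0 η Φ := by
  have h1 := ((isLinearMap_gradInner_right η.1).comp_fst (V := H0div Ω)).const_mul P.Pr
  have h2 := (((isLinearMap_inner_right (fld η.2)).comp_linearMap fldMap).comp_snd
    (U := Vel Ω)).const_mul P.κ
  have h3 := (isLinearMap_dForm₂ hemb hd P hB η.2).comp_fst (V := H0div Ω)
  have h4 := (isLinearMap_dForm₁ hemb hd P hB η.1).comp_snd (U := Vel Ω)
  exact ((h1.add' h2).add' h3).sub' h4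

theorem isLinearMap_B0_left (P : Data Ω) (Φ : Vel Ω × H0div Ω) :
    IsLinearMap ℝ fun ξ => P.B0 ξ Φ := by
  have h1 := (isLinearMap_bs₁ P Φ.1).comp_fst (V := L2 Ω ℝ)
  have h2 := (isLinearMap_bm₁ P Φ.2).comp_snd (U := L2 Ω ℝ)
  exact h1.add' h2

theorem isLinearMap_B0_right (P : Data Ω) (ξ : L2 Ω ℝ × L2 Ω ℝ) :
    IsLinearMap ℝ fun Φ => P.B0 ξ Φ := by
  have h1 := (isLinearMap_bs₂ P ξ.1).comp_fst (V := H0div Ω)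
  have h2 := (isLinearMap_bm₂ P ξ.2).comp_snd (U := Vel Ω)
  exact h1.add' h2

theorem isLinearMap_A1₁ (hemb : EmbeddingConstants Ω l1 l2 C) (η Φ : Vel Ω × H0div Ω) :
    IsLinearMap ℝ fun ζ => A1 ζ η Φ := by
  have h1 := ((isLinearMap_conv₁ hemb η.1 Φ.1).comp_fst (V := H0div Ω)).const_mul (1 / 2)
  have h2 := ((isLinearMap_conv₁ hemb Φ.1 η.1).comp_fst (V := H0div Ω)).const_mul (1 / 2)
  exact h1.sub' h2

theorem isLinearMap_A1₂ (hemb : EmbeddingConstants Ω l1 l2 C) (ζ Φ : Vel Ω × H0div Ω) :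
    IsLinearMap ℝ fun η => A1 ζ η Φ := by
  have h1 := ((isLinearMap_conv₂ hemb ζ.1 Φ.1).comp_fst (V := H0div Ω)).const_mul (1 / 2)
  have h2 := ((isLinearMap_conv₃ hemb ζ.1 Φ.1).comp_fst (V := H0div Ω)).const_mul (1 / 2)
  exact h1.sub' h2

theorem isLinearMap_A1₃ (hemb : EmbeddingConstants Ω l1 l2 C) (ζ η : Vel Ω × H0div Ω) :
    IsLinearMap ℝ fun Φ => A1 ζ η Φ := by
  have h1 := ((isLinearMap_conv₃ hemb ζ.1 η.1).comp_fst (V := H0div Ω)).const_mul (1 / 2)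
  have h2 := ((isLinearMap_conv₂ hemb ζ.1 η.1).comp_fst (V := H0div Ω)).const_mul (1 / 2)
  exact h1.sub' h2

theorem isLinearMap_H₁ (hemb : EmbeddingConstants Ω l1 l2 C) (θ r : H10 Ω) :
    IsLinearMap ℝ fun ζ => H ζ θ r := by
  have h1 := ((isLinearMap_convT₁ hemb θ r).comp_fst (V := H0div Ω)).const_mul (1 / 2)
  have h2 := ((isLinearMap_convT₁ hemb r θ).comp_fst (V := H0div Ω)).const_mul (1 / 2)
  exact h1.sub' h2

theorem isLinearMap_H₂ (hemb : EmbeddingConstants Ω l1 l2 C) (ζ : Vel Ω × H0div Ω) (r : H10 Ω) :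
    IsLinearMap ℝ fun θ => H ζ θ r := by
  have h1 := (isLinearMap_convT₂ hemb ζ.1 r).const_mul (1 / 2)
  have h2 := (isLinearMap_convT₃ hemb ζ.1 r).const_mul (1 / 2)
  exact h1.sub' h2

theorem isLinearMap_H₃ (hemb : EmbeddingConstants Ω l1 l2 C) (ζ : Vel Ω × H0div Ω) (θ : H10 Ω) :
    IsLinearMap ℝ fun r => H ζ θ r := by
  have h1 := (isLinearMap_convT₃ hemb ζ.1 θ).const_mul (1 / 2)
  have h2 := (isLinearMap_convT₂ hemb ζ.1 θ).const_mul (1 / 2)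
  exact h1.sub' h2

theorem isLinearMap_L (P : Data Ω) : IsLinearMap ℝ P.L := by
  have h1 := (IsLinearMap.mk (R := ℝ) (map_add P.f) (map_smul P.f)).comp_fst (V := H0div Ω)
  have h2 := (((isLinearMap_inner_right P.g).comp_linearMap fldMap).comp_snd
    (U := Vel Ω)).const_mul P.κ
  exact h1.add' h2

end Forms

/-! ### From the continuous forms to the discrete problems -/

section Discrete

variable {d : ℕ} {Ω : Set (EuclideanSpace ℝ (Fin d))} {l1 l2 C : ℝ}

variable {D G Z : Type*} [AddCommGroup D] [Module ℝ D] [AddCommGroup G] [Module ℝ G]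
  [AddCommGroup Z] [Module ℝ Z]

/-- The forms of the problem on spaces `D`, `G`, `Z` that are mapped to the continuous ones. -/
def pulledBackForms (hemb : EmbeddingConstants Ω l1 l2 C) (hd : d = 2 ∨ d = 3) (P : Data Ω)
    (hdir : ‖P.dir‖ = 1) (hB : MemLp P.B 3 (volume.restrict Ω)) (i : D →ₗ[ℝ] Vel Ω × H0div Ω)
    (j : G →ₗ[ℝ] L2 Ω ℝ × L2 Ω ℝ) (k : Z →ₗ[ℝ] H10 Ω) : CoupledForms D G Z where
  a := bilinOfIsLinear (fun x y => P.A0 (i x) (i y))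
    (fun y => (isLinearMap_A0_left hemb hd P hB (i y)).comp_linearMap i)
    (fun x => (isLinearMap_A0_right hemb hd P hB (i x)).comp_linearMap i)
  n := trilinOfIsLinear (fun x y z => A1 (i x) (i y) (i z))
    (fun y z => (isLinearMap_A1₁ hemb (i y) (i z)).comp_linearMap i)
    (fun x z => (isLinearMap_A1₂ hemb (i x) (i z)).comp_linearMap i)
    (fun x y => (isLinearMap_A1₃ hemb (i x) (i y)).comp_linearMap i)
  b := bilinOfIsLinear (fun g x => P.B0 (j g) (i x))
    (fun x => (isLinearMap_B0_left P (i x)).comp_linearMap j)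
    (fun g => (isLinearMap_B0_right P (j g)).comp_linearMap i)
  q := bilinOfIsLinear (fun z x => P.Q (k z) (i x))
    (fun x => (isLinearMap_Q₁ hemb P hdir (i x)).comp_linearMap k)
    (fun z => (isLinearMap_Q₂ hemb P hdir (k z)).comp_linearMap i)
  e := bilinOfIsLinear (fun z r => eForm (k z) (k r))
    (fun r => (isLinearMap_inner_left (grad (k r))).comp_linearMap (gradMap ∘ₗ k))
    (fun z => (isLinearMap_inner_right (grad (k z))).comp_linearMap (gradMap ∘ₗ k))
  h := trilinOfIsLinear (fun x z r => H (i x) (k z) (k r))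
    (fun z r => (isLinearMap_H₁ hemb (k z) (k r)).comp_linearMap i)
    (fun x r => (isLinearMap_H₂ hemb (i x) (k r)).comp_linearMap k)
    (fun x z => (isLinearMap_H₃ hemb (i x) (k z)).comp_linearMap k)
  L := ((isLinearMap_L P).comp_linearMap i).mk'
  φ := P.φ.toLinearMap ∘ₗ k

/-- `norm1` as a seminorm on a space that is mapped to the velocities and currents. -/
def energySeminorm (i : D →ₗ[ℝ] Vel Ω × H0div Ω) : Seminorm ℝ D :=
  hypotSeminorm ((normSeminorm ℝ _).comp (velGradMap ∘ₗ LinearMap.fst ℝ _ _ ∘ₗ i))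
    ((normSeminorm ℝ _).comp (fldDvMap ∘ₗ LinearMap.snd ℝ _ _ ∘ₗ i))

theorem energySeminorm_apply (i : D →ₗ[ℝ] Vel Ω × H0div Ω) (x : D) :
    energySeminorm i x = norm1 (i x) := by
  rw [norm1, ← gradSeminorm_apply, ← divSeminorm_apply]
  rfl

theorem le_mul_mul_of_eq {t l a b a' b' : ℝ} (h : t ≤ l * a * b) (ha : a' = a) (hb : b' = b) :
    t ≤ l * a' * b' := by
  rwa [ha, hb]

theorem le_mul_mul_mul_of_eq {t l a b c a' b' c' : ℝ} (h : t ≤ l * a * b * c) (ha : a' = a)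
    (hb : b' = b) (hc : c' = c) : t ≤ l * a' * b' * c' := by
  rwa [ha, hb, hc]

theorem estimates_pulledBackForms (hemb : EmbeddingConstants Ω l1 l2 C) (hd : d = 2 ∨ d = 3)
    (P : Data Ω) (hPr : 0 < P.Pr) (hκ : 0 < P.κ) (hRa : 0 ≤ P.Ra) (hdir : ‖P.dir‖ = 1)
    (hB : MemLp P.B 3 (volume.restrict Ω)) (i : D →ₗ[ℝ] Vel Ω × H0div Ω)
    (j : G →ₗ[ℝ] L2 Ω ℝ × L2 Ω ℝ) (k : Z →ₗ[ℝ] H10 Ω) (hi : ∀ x, i x = 0 → x = 0)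
    (hj : ∀ g, j g = 0 → g = 0) (hk : ∀ z, k z = 0 → z = 0)
    (pD : Seminorm ℝ D) (hD : ∀ x, pD x = norm1 (i x)) (pZ : Seminorm ℝ Z)
    (hZ : ∀ z, pZ z = ‖grad (k z)‖) (hdiv : ∀ x, ∃ g, j g = (0, dv (i x).2)) {β : ℝ} (hβ : 0 < β)
    (hinf : ∀ g m, 0 ≤ m → (∀ x, P.B0 (j g) (i x) ≤ m * norm1 (i x)) → β * norm0 (j g) ≤ m) :
    (pulledBackForms hemb hd P hdir hB i j k).Estimates pD (fun g => norm0 (j g)) pZ P.Cmin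
      (P.Cmax l1) l2 (P.lamq C) P.normL P.lamφ β := by
  constructor
  case pD_def => exact fun x hx => hi x (hemb.eq_zero_of_norm1 _ (by rwa [← hD]))
  case pG_def =>
    intro g hg
    have h1 := (Real.sqrt_eq_zero (by positivity)).1 hg
    obtain ⟨h2, h3⟩ := (add_eq_zero_iff_of_nonneg (sq_nonneg _) (sq_nonneg _)).1 h1
    exact hj g (Prod.ext (norm_eq_zero.1 (pow_eq_zero_iff two_ne_zero |>.1 h2))
      (norm_eq_zero.1 (pow_eq_zero_iff two_ne_zero |>.1 h3)))
  case pG_nonneg => exact fun g => Real.sqrt_nonneg _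
  case pZ_def => exact fun z hz => hk z (hemb.eq_zero_of_norm_grad _ (by rwa [← hZ]))
  case c_pos => exact lt_min hPr hκ
  case β_pos => exact hβ
  case M_nonneg =>
    exact mul_nonneg zero_le_two (hPr.le.trans ((le_max_left _ _).trans (le_max_left _ _)))
  case l_nonneg => exact hemb.l2_pos.le
  case lq_nonneg => exact mul_nonneg (mul_nonneg hPr.le hRa) (sq_nonneg C)
  case lL_nonneg => exact Real.sqrt_nonneg _
  case lφ_nonneg => exact (hemb.dualNorm_spec P.φ).1
  case coercive =>
    intro x hx
    -- The divergence of the discrete current is itself an admissible multiplier; testing the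
    -- constraint with it gives -κ‖∇·J‖² = 0.
    obtain ⟨g, hg⟩ := hdiv x
    have h1 : P.B0 (j g) (i x) = 0 := hx g
    have h2 : P.bs 0 (i x).1 = 0 := ((isLinearMap_bs₁ P (i x).1).mk' _).map_zero
    rw [hg, Data.B0, h2, zero_add, Data.bm, real_inner_self_eq_norm_sq] at h1
    have h3 : dv (i x).2 = 0 := by
      simpa only [neg_mul, neg_eq_zero, mul_eq_zero, hκ.ne', false_or,
        pow_eq_zero_iff two_ne_zero, norm_eq_zero] using h1
    exact (congrArg (fun t => P.Cmin * t ^ 2) (hD x)).trans_le (coercive_A0 (i x) h3)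
  case a_le =>
    exact fun x y => le_mul_mul_of_eq (hemb.abs_A0_le hd hPr hκ hB (i x) (i y)) (hD x) (hD y)
  case n_self => exact fun x y => A1_self (i x) (i y)
  case n_le =>
    exact fun x y z =>
      le_mul_mul_mul_of_eq (hemb.abs_A1_le (i x) (i y) (i z)) (hD x) (hD y) (hD z)
  case h_self => exact fun x z => H_self (i x) (k z)
  case h_le =>
    exact fun x z r =>
      le_mul_mul_mul_of_eq (hemb.abs_H_le (i x) (k z) (k r)) (hD x) (hZ z) (hZ r)
  case e_self =>
    exact fun z => (real_inner_self_eq_norm_sq (grad (k z))).trans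
      (congrArg (· ^ 2) (hZ z).symm)
  case q_le =>
    exact fun z x => le_mul_mul_of_eq (hemb.abs_Q_le hPr hRa hdir (k z) (i x)) (hZ z) (hD x)
  case L_le => exact fun x => (hemb.L_le hκ (i x)).trans_eq (congrArg (P.normL * ·) (hD x).symm)
  case φ_le =>
    exact fun z => ((hemb.dualNorm_spec P.φ).2 (k z)).trans_eq
      (congrArg (P.lamφ * ·) (hZ z).symm)
  case infsup =>
    exact fun g m hm h => hinf g m hm fun x => (h x).trans_eq (congrArg (m * ·) (hD x))

theorem le_of_forall_lt_one_mul_le_real {t m : ℝ} (h : ∀ k < 1, k * t ≤ m) :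
    t ≤ m := by
  by_contra! hlt
  have hm : 0 ≤ m := by simpa using h 0 one_pos
  have ht0 : 0 < t := hm.trans_lt hlt
  -- This k makes k·t the midpoint of m and t, which exceeds m.
  have h1 := h ((m + t) / (2 * t)) ((div_lt_one (by positivity)).2 (by linarith))
  have h2 : (m + t) / (2 * t) * t = (m + t) / 2 := by field_simp
  linarith

/-- The two inf-sup conditions combine to one for the sum of the forms. -/
theorem infSup_combined (hemb : EmbeddingConstants Ω l1 l2 C) {P : Data Ω} {V : FESpaces Ω}
    {βs βm : ℝ} (hβs : 0 < βs) (hβm : 0 < βm) (hinfs : InfSupS P V βs) (hinfm : InfSupM P V βm)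
    {q ψ : L2 Ω ℝ} (hq : q ∈ V.Eh) (hψ : ψ ∈ V.Sh) {m : ℝ} (hm : 0 ≤ m)
    (h : ∀ w ∈ V.Xh, ∀ K ∈ V.Yh, P.B0 (q, ψ) (w, K) ≤ m * norm1 (w, K)) :
    min βs βm * norm0 (q, ψ) ≤ m := by
  have hN : ∀ K : H0div Ω, divSeminorm K = 0 → K = 0 := fun K hK => by
    have h1 : fldDvMap K = 0 := norm_eq_zero.1 hK
    exact Subtype.ext ((WithLp.toLp_injective 2) h1)
  have hG : ∀ v : Vel Ω, gradSeminorm v = 0 → v = 0 := fun v hv =>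
    hemb.eq_zero_of_gradNorm v (by rwa [← gradSeminorm_apply])
  -- Test functions of norms βs‖q‖ and βm‖ψ‖ form a pair of norm s, on which the form is at least
  -- k·s². Hence k·s ≤ m for every k < 1.
  set s := √((βs * ‖q‖) ^ 2 + (βm * ‖ψ‖) ^ 2) with hs
  have hs0 : 0 ≤ s := Real.sqrt_nonneg _
  have hsm : s ≤ m := by
    refine le_of_forall_lt_one_mul_le_real fun k hk => ?_
    obtain ⟨w, hw, hw1, hw2⟩ := exists_test_of_infSup V.Xh gradSeminorm hG (P.bs q)
      (isLinearMap_bs₂ P q) hβs (norm_nonneg q) hk fun hq0 => by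
        simpa only [gradSeminorm_apply] using hinfs q hq (norm_ne_zero_iff.1 hq0)
    obtain ⟨K, hK, hK1, hK2⟩ := exists_test_of_infSup V.Yh divSeminorm hN (P.bm ψ)
      (isLinearMap_bm₂ P ψ) hβm (norm_nonneg ψ) hk fun hq0 => by
        simpa only [divSeminorm_apply] using hinfm ψ hψ (norm_ne_zero_iff.1 hq0)
    have h1 := h w hw K hK
    have h2 : norm1 (w, K) = s := by
      rw [norm1, ← gradSeminorm_apply, ← divSeminorm_apply, hw1, hK1]
    have h3 : s * s = (βs * ‖q‖) ^ 2 + (βm * ‖ψ‖) ^ 2 := Real.mul_self_sqrt (by positivity)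
    rw [h2, Data.B0] at h1
    rcases hs0.eq_or_lt with h0 | h0
    · rw [← h0, mul_zero]
      exact hm
    · refine le_of_mul_le_mul_right ?_ h0
      rw [mul_assoc, h3]
      linarith
  refine le_trans ?_ hsm
  have hmin : 0 < min βs βm := lt_min hβs hβm
  rw [norm0, ← Real.sqrt_sq hmin.le, ← Real.sqrt_mul (sq_nonneg _), hs]
  apply Real.sqrt_le_sqrt
  rw [mul_add, ← mul_pow, ← mul_pow]
  gcongr
  · exact min_le_left _ _
  · exact min_le_right _ _

/-- Well-posedness and convergence of the Newton iteration on finite dimensional spaces that are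
mapped linearly into the continuous ones. -/
theorem newton_convergence_of_isLinearMap [FiniteDimensional ℝ D] [FiniteDimensional ℝ G]
    [FiniteDimensional ℝ Z] (hemb : EmbeddingConstants Ω l1 l2 C) (hd : d = 2 ∨ d = 3)
    (P : Data Ω) (hPr : 0 < P.Pr) (hκ : 0 < P.κ) (hRa : 0 ≤ P.Ra) (hdir : ‖P.dir‖ = 1)
    (hB : MemLp P.B 3 (volume.restrict Ω)) (η : D → Vel Ω × H0div Ω) (hη : IsLinearMap ℝ η)
    (ξ : G → L2 Ω ℝ × L2 Ω ℝ) (hξ : IsLinearMap ℝ ξ) (θ : Z → H10 Ω) (hθ : IsLinearMap ℝ θ)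
    (hη0 : ∀ x, η x = 0 → x = 0) (hξ0 : ∀ g, ξ g = 0 → g = 0) (hθ0 : ∀ z, θ z = 0 → z = 0)
    (hdiv : ∀ x, ∃ g, ξ g = (0, dv (η x).2)) {β : ℝ} (hβ : 0 < β)
    (hinf : ∀ g m, 0 ≤ m → (∀ x, P.B0 (ξ g) (η x) ≤ m * norm1 (η x)) → β * norm0 (ξ g) ≤ m)
    (hσ0 : 0 < P.sigma l2 C) (hσ1 : P.sigma l2 C < 1 / 3) :
    ∃ (s : D × G × Z) (x : ℕ → D × G × Z),
      (∀ y : D × G × Z, (∀ t : D × G × Z,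
        P.A0 (η y.1) (η t.1) + A1 (η y.1) (η y.1) (η t.1) + P.B0 (ξ y.2.1) (η t.1) +
          P.Q (θ y.2.2) (η t.1) = P.L (η t.1) ∧
        P.B0 (ξ t.2.1) (η y.1) = 0 ∧
        eForm (θ y.2.2) (θ t.2.2) + H (η y.1) (θ y.2.2) (θ t.2.2) = P.φ (θ t.2.2)) ↔ y = s) ∧
      (∀ y : D × G × Z, (∀ t : D × G × Z,
        P.A0 (η y.1) (η t.1) + P.B0 (ξ y.2.1) (η t.1) + P.Q (θ y.2.2) (η t.1) = P.L (η t.1) ∧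
        P.B0 (ξ t.2.1) (η y.1) = 0 ∧
        eForm (θ y.2.2) (θ t.2.2) = P.φ (θ t.2.2)) ↔ y = x 0) ∧
      (∀ n, ∀ y : D × G × Z, (∀ t : D × G × Z,
        P.A0 (η y.1) (η t.1) + A1 (η (x n).1) (η y.1) (η t.1) + A1 (η y.1) (η (x n).1) (η t.1) -
          A1 (η (x n).1) (η (x n).1) (η t.1) + P.B0 (ξ y.2.1) (η t.1) +
          P.Q (θ y.2.2) (η t.1) = P.L (η t.1) ∧
        P.B0 (ξ t.2.1) (η y.1) = 0 ∧
        eForm (θ y.2.2) (θ t.2.2) + H (η (x n).1) (θ y.2.2) (θ t.2.2) +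
          H (η y.1) (θ (x n).2.2) (θ t.2.2) - H (η (x n).1) (θ (x n).2.2) (θ t.2.2) =
          P.φ (θ t.2.2)) ↔ y = x (n + 1)) ∧
      ∀ n,
        norm1 (η (x n).1) ≤ 4 / 3 * P.bound C ∧
        ‖grad (θ (x n).2.2)‖ ≤ 4 / 3 * P.lamφ ∧
        norm1 (η s.1 - η (x n).1) ≤ (9 / 5 * P.sigma l2 C) ^ (2 ^ n - 1) * P.bound C ∧
        ‖grad (θ s.2.2 - θ (x n).2.2)‖ ≤ (9 / 5 * P.sigma l2 C) ^ (2 ^ n - 1) * P.lamφ ∧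
        β * norm0 (ξ s.2.1 - ξ (x n).2.1) ≤
          (P.Cmax l1 + 22 / 9 * P.Cmin) * (9 / 5 * P.sigma l2 C) ^ (2 ^ n - 1) * P.bound C := by
  have hc : 0 < P.Cmin := lt_min hPr hκ
  have hR : P.Cmin * P.bound C = P.normL + P.lamq C * P.lamφ := by
    rw [Data.bound]
    field_simp
  -- The four terms of σ factor as λ₂(‖L‖_* + λ_q λ_φ)(1/c² + 1/c), with c = `Cmin`.
  have hσ : P.Cmin * P.sigma l2 C = l2 * P.bound C + P.Cmin * (l2 * P.bound C) := by
    rw [Data.bound, Data.sigma]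
    field_simp
    ring
  have E := estimates_pulledBackForms hemb hd P hPr hκ hRa hdir hB hη.mk' hξ.mk' hθ.mk' hη0 hξ0 hθ0
    (energySeminorm hη.mk') (energySeminorm_apply hη.mk')
    ((normSeminorm ℝ _).comp (gradMap ∘ₗ hθ.mk')) (fun z => rfl) hdiv hβ hinf
  obtain ⟨s, x, h1, h2, h3, h4⟩ := E.newton_convergence hR hσ hσ0 hσ1
  refine ⟨s, x, h1, h2, h3, fun n => ?_⟩
  obtain ⟨b1, b2, b3, b4, b5⟩ := h4 n
  have e1 : η (s.1 - (x n).1) = η s.1 - η (x n).1 := hη.mk'.map_sub _ _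
  have e2 : θ (s.2.2 - (x n).2.2) = θ s.2.2 - θ (x n).2.2 := hθ.mk'.map_sub _ _
  have e3 : ξ (s.2.1 - (x n).2.1) = ξ s.2.1 - ξ (x n).2.1 := hξ.mk'.map_sub _ _
  rw [← e1, ← e2, ← e3]
  exact ⟨(energySeminorm_apply hη.mk' _).symm.trans_le b1, b2,
    (energySeminorm_apply hη.mk' _).symm.trans_le b3, b4, b5⟩

end Discrete

end IMHD

end

/-! ### The theorem for conforming discrete spaces -/

open IMHD
theorem theorem4p3 (d : ℕ) (hd : d = 2 ∨ d = 3)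
    (Ω : Set (EuclideanSpace ℝ (Fin d))) (hΩo : IsOpen Ω) (hΩb : Bornology.IsBounded Ω)
    (l1 l2 C : ℝ) (hemb : EmbeddingConstants Ω l1 l2 C)
    (P : Data Ω) (hPr : 0 < P.Pr) (hκ : 0 < P.κ) (hRa : 0 ≤ P.Ra) (hdir : ‖P.dir‖ = 1)
    (hB : MemLp P.B 3 (volume.restrict Ω))
    (hB2 : d = 2 → ∀ x ∈ Ω, P.B x 0 = 0 ∧ P.B x 1 = 0)
    (V : FESpaces Ω) (hdiv : ∀ K ∈ V.Yh, dv K ∈ V.Sh)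
    (βs βm : ℝ) (hβs : 0 < βs) (hβm : 0 < βm)
    (hinfs : InfSupS P V βs) (hinfm : InfSupM P V βm)
    (hσ0 : 0 < P.sigma l2 C) (hσ1 : P.sigma l2 C < 1 / 3) :
    ∃ (s : V.State) (x : ℕ → V.State),
      (∀ y : V.State, IsDiscreteSolution P y ↔ y = s) ∧
      (∀ y : V.State, IsInitial P y ↔ y = x 0) ∧
      (∀ n, ∀ y : V.State, IsNewtonStep P (x n) y ↔ y = x (n + 1)) ∧
      ∀ n,
        norm1 (x n).eta ≤ 4 / 3 * P.bound C ∧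
        ‖grad (x n).theta‖ ≤ 4 / 3 * P.lamφ ∧
        norm1 (s.eta - (x n).eta) ≤ (9 / 5 * P.sigma l2 C) ^ (2 ^ n - 1) * P.bound C ∧
        ‖grad (s.theta - (x n).theta)‖ ≤ (9 / 5 * P.sigma l2 C) ^ (2 ^ n - 1) * P.lamφ ∧
        min βs βm * norm0 (s.xi - (x n).xi) ≤
          (P.Cmax l1 + 22 / 9 * P.Cmin) * (9 / 5 * P.sigma l2 C) ^ (2 ^ n - 1) * P.bound C := by
  have := V.finXh
  have := V.finYh
  have := V.finEh
  have := V.finSh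
  have := V.finZh
  exact newton_convergence_of_isLinearMap (D := V.Xh × V.Yh) (G := V.Eh × V.Sh) (Z := V.Zh)
    hemb hd P hPr hκ hRa hdir hB
    (fun x => ((x.1 : Vel Ω), (x.2 : H0div Ω))) ⟨fun _ _ => rfl, fun _ _ => rfl⟩
    (fun g => ((g.1 : L2 Ω ℝ), (g.2 : L2 Ω ℝ))) ⟨fun _ _ => rfl, fun _ _ => rfl⟩
    (fun z => (z : H10 Ω)) ⟨fun _ _ => rfl, fun _ _ => rfl⟩
    (fun x hx => Prod.ext (Subtype.ext (congrArg Prod.fst hx))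
      (Subtype.ext (congrArg Prod.snd hx)))
    (fun g hg => Prod.ext (Subtype.ext (congrArg Prod.fst hg))
      (Subtype.ext (congrArg Prod.snd hg)))
    (fun z hz => Subtype.ext hz) (fun x => ⟨(0, ⟨dv (x.2 : H0div Ω), hdiv x.2 x.2.2⟩), rfl⟩)
    (lt_min hβs hβm) (fun g m hm h => infSup_combined hemb hβs hβm hinfs hinfm g.1.2 g.2.2 hm
      fun w hw K hK => h (⟨w, hw⟩, ⟨K, hK⟩)) hσ0 hσ1
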